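/- **Setting.** Let $d\ge 1$ and let $\Omega\subset\mathbb{R}^d$ be a bounded polyhedral open set with a finite conforming simplicial mesh $\mathcal{T}_h$: the nondegenerate closed simplices $K\in\mathcal{T}_h$ fill $\overline\Omega$, two of them meet in the face spanned by their common vertices, and $\partial\Omega$ is a union of faces. Let $a,c\in W^{1,\infty}(\Omega)$, $\boldsymbol b\in W^{1,\infty}(\Omega)^d$, $f\in W^{1,2}(\Omega)$ with $a\ge a_0>0$ and $c-\tfrac12\nabla\cdot\boldsymbol b\ge 0$ a.e. in $\Omega$. For $r\ge 0$ let $$V_h=\{v\in H^1_0(\Omega)\cap C(\overline\Omega):\ v|_K\in P_r(K)\ \ \forall K\in\mathcal{T}_h\}$$ with a basis $\psi_1,\dots,\psi_n$. The finite element solution $u_h\in V_h$ satisfies $$\int_\Omega\big(a\nabla u_h\cdot\nabla\psi+(\boldsymbol b\cdot\nabla u_h)\psi+c\,u_h\psi\big)\,dx=\int_\Omega f\psi\,dx\qquad\forall\psi\in V_h .$$ **Mesh deformation.** Let $\dot X$ be a smooth vector field on $\Omega$, bounded with bounded gradient. Keeping the connectivity, move the mesh vertices by $\boldsymbol x_i(t)=\boldsymbol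 x_i+t\,\dot{\boldsymbol x}_i$, $0\le t<\delta$, where $\delta>0$, $\dot{\boldsymbol x}_i=\dot X(\boldsymbol x_i)$ if $\boldsymbol x_i\in\Omega$ and $\dot{\boldsymbol x}_i=0$ if $\boldsymbol x_i\in\partial\Omega$. For $K$ with vertices $\boldsymbol x_0^K,\dots,\boldsymbol x_d^K$ (in any order) put $E_K=[\boldsymbol x_1^K-\boldsymbol x_0^K,\dots,\boldsymbol x_d^K-\boldsymbol x_0^K]$ and $\dot E_K=[\dot{\boldsymbol x}_1^K-\dot{\boldsymbol x}_0^K,\dots,\dot{\boldsymbol x}_d^K-\dot{\boldsymbol x}_0^K]$; let $K(t)$ be the deformed simplex, $F_{K(t)}:K\to K(t)$ the affine map that takes vertices to the corresponding vertices, and $\dot X_h=\sum_i\dot{\boldsymbol x}_i\phi_i$ with $\phi_i$ the continuous piecewise linear nodal basis functions. For $v\in V_h$ let $\tilde v$ be the function given on each $K(t)$ by $\tilde v=v\circ F_{K(t)}^{-1}$. Suppose that $u(t)=\sum_i u_i(t)\psi_i$, $0\le t<\delta$, is such that $u(0)=u_h$, that for $0<t<\delta$ the transported function $\tilde u_h$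 of $u(t)$ is a finite element solution on the deformed mesh, i.e. $$\sum_{K}\int_{K(t)}\big(a\,\tilde\nabla\tilde u_h\cdot\tilde\nabla\tilde\psi+(\boldsymbol b\cdot\tilde\nabla\tilde u_h)\tilde\psi+c\,\tilde u_h\tilde\psi\big)\,dy=\sum_K\int_{K(t)}f\,\tilde\psi\,dy\qquad\forall\psi\in V_h ,$$ where $\tilde\nabla$ is the gradient in $y$, and that the coefficients $u_i(t)$ are (right-)differentiable at $t=0$. Let $\dot u_h=\sum_i\dot u_i(0)\psi_i$ be the material derivative. **Theorem 3.1.** Then $\dot u_h\in V_h$ and, for all $\psi\in V_h$, $$\begin{aligned} &\int_\Omega\big(a\nabla\dot u_h\cdot\nabla\psi+(\boldsymbol b\cdot\nabla\dot u_h)\psi+c\,\dot u_h\psi\big)\,dx\\ &=\sum_K\int_K\Big(a\,\nabla u_h\cdot\big(\dot E_KE_K^{-1}+E_K^{-T}\dot E_K^{T}\big)\nabla\psi+\big(\boldsymbol b\cdot E_K^{-T}\dot E_K^{T}\nabla u_h\big)\psi\Big)dx\\ &\quad-\int_\Omega\Big((\nabla a\cdot\dot X_h)(\nabla u_h\cdot\nabla\psi)+a(\nabla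 u_h\cdot\nabla\psi)(\nabla\cdot\dot X_h)\Big)dx\\ &\quad-\int_\Omega\Big(\big(\dot X_h\cdot\nabla\boldsymbol b\cdot\nabla u_h\big)\psi+(\boldsymbol b\cdot\nabla u_h)\psi(\nabla\cdot\dot X_h)\Big)dx\\ &\quad+\int_\Omega\Big(c\,\psi(\nabla u_h\cdot\dot X_h)+c\,u_h(\nabla\psi\cdot\dot X_h)\Big)dx-\int_\Omega f(\nabla\psi\cdot\dot X_h)\,dx , \end{aligned}$$ where $\dot X_h\cdot\nabla\boldsymbol b\cdot\nabla u_h=\sum_{i,j}(\dot X_h)_j(\partial_jb_i)(\partial_iu_h)$. -/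

import Mathlib

open MeasureTheory Set Filter Topology
open scoped ContDiff Gradient Matrix ENNReal

noncomputable section

namespace MeshSens

/-- The space `ℝ^d` with the Euclidean norm. -/
abbrev E (d : ℕ) : Type := EuclideanSpace ℝ (Fin d)

variable {d : ℕ}

/-- The matrix `A` acting on the vector `x`. -/
def mulE (A : Matrix (Fin d) (Fin d) ℝ) (x : E d) : E d := WithLp.toLp 2 (A *ᵥ x.ofLp)

/-! ### Sobolev spaces on an open set -/

/-- Test functions `C_c^∞(Ω)`. -/
def IsTestFunction (Ω : Set (E d)) (φ : E d → ℝ) : Prop :=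
  ContDiff ℝ ∞ φ ∧ HasCompactSupport φ ∧ tsupport φ ⊆ Ω

/-- `g` is the weak gradient of `u` on `Ω`:
`∫_Ω u ∂_i φ = - ∫_Ω g_i φ` for every test function `φ` and every `i`. -/
def HasWeakGradient (Ω : Set (E d)) (u : E d → ℝ) (g : E d → E d) : Prop :=
  ∀ φ : E d → ℝ, IsTestFunction Ω φ → ∀ i : Fin d,
    ∫ x in Ω, u x * (∇ φ x) i = - ∫ x in Ω, g x i * φ x

/-- `u ∈ W^{1,p}(Ω)`, with weak gradient (represented by) `g`. -/
structure IsSobolevWith (Ω : Set (E d)) (p : ℝ≥0∞) (u : E d → ℝ) (g : E d → E d) : Prop where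
  memLp : MemLp u p (volume.restrict Ω)
  memLp_grad : MemLp g p (volume.restrict Ω)
  weak : HasWeakGradient Ω u g

/-- `u ∈ H_0^1(Ω)`: the function `u` lies in `H^1(Ω)` and is the limit in `H^1(Ω)` of a sequence
of test functions. -/
def MemH10 (Ω : Set (E d)) (u : E d → ℝ) : Prop :=
  ∃ g : E d → E d, IsSobolevWith Ω 2 u g ∧
    ∃ φ : ℕ → E d → ℝ, (∀ n, IsTestFunction Ω (φ n)) ∧
      Tendsto (fun n => eLpNorm (fun x => φ n x - u x) 2 (volume.restrict Ω)) atTop (𝓝 0) ∧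
      Tendsto (fun n => eLpNorm (fun x => ∇ (φ n) x - g x) 2 (volume.restrict Ω)) atTop (𝓝 0)

/-! ### Simplices -/

/-- The edge matrix `[p_1 - p_0, ..., p_d - p_0]` of the points `p_0, ..., p_d`. -/
def edgeMatrix (p : Fin (d + 1) → E d) : Matrix (Fin d) (Fin d) ℝ :=
  Matrix.of fun i j => p j.succ i - p 0 i

/-- The linear Lagrange basis functions (barycentric coordinates) of the simplex with vertices
`p_0, ..., p_d`: the affine functions with `φ_i (p_j) = δ_ij`. -/
def lagrange (p : Fin (d + 1) → E d) (j : Fin (d + 1)) (x : E d) : ℝ :=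
  Fin.cases (1 - ∑ k, mulE (edgeMatrix p)⁻¹ (x - p 0) k)
    (fun k => mulE (edgeMatrix p)⁻¹ (x - p 0) k) j

/-- The affine map taking the simplex with vertices `p` to the simplex with vertices `q`,
`x ↦ q_0 + E_q E_p⁻¹ (x - p_0)`. -/
def elementMap (p q : Fin (d + 1) → E d) (x : E d) : E d :=
  q 0 + mulE (edgeMatrix q * (edgeMatrix p)⁻¹) (x - p 0)

/-! ### Simplicial meshes -/

/-- A conforming simplicial mesh with nodes indexed by `N` and elements indexed by `T`, given by
the positions of the nodes and the connectivity (the numbering of the vertices of an element is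
arbitrary). -/
structure SimplicialMesh (d : ℕ) (N T : Type*) where
  /-- positions of the nodes -/
  pos : N → E d
  /-- vertices of each element -/
  conn : T → Fin (d + 1) → N
  nondegenerate : ∀ K, (edgeMatrix (pos ∘ conn K)).det ≠ 0
  distinct : ∀ K L, range (conn K) = range (conn L) → K = L
  node_used : ∀ i, ∃ K, i ∈ range (conn K)
  /-- two elements meet in the common face spanned by their common vertices -/
  conforming : ∀ K L,
    convexHull ℝ (range (pos ∘ conn K)) ∩ convexHull ℝ (range (pos ∘ conn L)) ⊆
      convexHull ℝ (pos '' (range (conn K) ∩ range (conn L)))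

variable {N T : Type*}

namespace SimplicialMesh

/-- Vertices of the element `K`. -/
def vert (M : SimplicialMesh d N T) (K : T) : Fin (d + 1) → E d := M.pos ∘ M.conn K

/-- The closed simplex `K`. -/
def elem (M : SimplicialMesh d N T) (K : T) : Set (E d) := convexHull ℝ (range (M.vert K))

/-- `M` (with finitely many elements) is a mesh of the bounded polyhedral domain `Ω`: the elements fill `closure Ω`, and the
boundary of `Ω` is a union of faces of elements. -/
structure IsMeshOf (M : SimplicialMesh d N T) (Ω : Set (E d)) : Prop where
  isOpen : IsOpen Ω
  cover : ⋃ K, M.elem K = closure Ω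
  boundary : ∀ x ∈ frontier Ω, ∃ (K : T) (s : Set (Fin (d + 1))),
    x ∈ convexHull ℝ (M.vert K '' s) ∧ convexHull ℝ (M.vert K '' s) ⊆ frontier Ω

open Classical in
/-- The continuous piecewise linear basis function of node `i` : on each element `K` it is the
linear Lagrange basis function of the vertex `i` of `K` (zero if `i` is not a vertex of `K`).
By conformity the choice of the element containing `x` does not matter. -/
def hat (M : SimplicialMesh d N T) (i : N) (x : E d) : ℝ :=
  if h : ∃ K, x ∈ M.elem K then
    ∑ j, if M.conn h.choose j = i then lagrange (M.vert h.choose) j x else 0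
  else 0

open Classical in
/-- Nodal velocities: the interior nodes move with the velocity field `X`, the boundary nodes
are fixed. -/
def nodeVel (M : SimplicialMesh d N T) (Ω : Set (E d)) (X : E d → E d) (i : N) : E d :=
  if M.pos i ∈ Ω then X (M.pos i) else 0

/-- Vertices at time `t` of the element `K` of the deformed mesh. -/
def vertAt (M : SimplicialMesh d N T) (Ω : Set (E d)) (X : E d → E d) (t : ℝ) (K : T) :
    Fin (d + 1) → E d :=
  fun j => M.vert K j + t • M.nodeVel Ω X (M.conn K j)

/-- The element `K(t)` of the deformed mesh. -/
def elemAt (M : SimplicialMesh d N T) (Ω : Set (E d)) (X : E d → E d) (t : ℝ) (K : T) :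
    Set (E d) :=
  convexHull ℝ (range (M.vertAt Ω X t K))

/-- The edge matrix `E_K`. -/
def edge (M : SimplicialMesh d N T) (K : T) : Matrix (Fin d) (Fin d) ℝ := edgeMatrix (M.vert K)

/-- The time derivative of the edge matrix of `K`, i.e. the edge matrix of the nodal velocities. -/
def edgeVel (M : SimplicialMesh d N T) (Ω : Set (E d)) (X : E d → E d) (K : T) :
    Matrix (Fin d) (Fin d) ℝ :=
  edgeMatrix fun j => M.nodeVel Ω X (M.conn K j)

/-- The piecewise linear velocity field `∑ᵢ ẋᵢ φᵢ`. -/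
def velInterp [Fintype N] (M : SimplicialMesh d N T) (Ω : Set (E d)) (X : E d → E d) (x : E d) : E d :=
  ∑ i, M.hat i x • M.nodeVel Ω X i

/-- The function on `K(t)` that corresponds to `v` on `K` under the affine map `K → K(t)`,
i.e. the composition of `v` with the inverse map `K(t) → K`. -/
def push (M : SimplicialMesh d N T) (Ω : Set (E d)) (X : E d → E d) (t : ℝ) (K : T)
    (v : E d → ℝ) : E d → ℝ :=
  fun y => v (elementMap (M.vertAt Ω X t K) (M.vert K) y)

end SimplicialMesh

/-- Divergence of a vector field (used for fields that are differentiable almost everywhere). -/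
def divergence (X : E d → E d) (x : E d) : ℝ :=
  ∑ i, fderiv ℝ X x (EuclideanSpace.single i 1) i

/-! ### The finite element space -/

theorem IsTestFunction.zero (Ω : Set (E d)) : IsTestFunction Ω (0 : E d → ℝ) := by
  refine ⟨contDiff_const, HasCompactSupport.zero, ?_⟩
  simp

theorem IsTestFunction.add {Ω : Set (E d)} {φ ψ : E d → ℝ} (hφ : IsTestFunction Ω φ)
    (hψ : IsTestFunction Ω ψ) : IsTestFunction Ω (φ + ψ) :=
  ⟨hφ.1.add hψ.1, hφ.2.1.add hψ.2.1,
    (tsupport_add φ ψ).trans (union_subset hφ.2.2 hψ.2.2)⟩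

theorem IsTestFunction.smul {Ω : Set (E d)} {φ : E d → ℝ} (c : ℝ) (hφ : IsTestFunction Ω φ) :
    IsTestFunction Ω (c • φ) :=
  ⟨hφ.1.const_smul c, hφ.2.1.smul_left (f := fun _ => c),
    (closure_mono (Function.support_const_smul_subset c φ)).trans hφ.2.2⟩

theorem IsTestFunction.diff {Ω : Set (E d)} {φ : E d → ℝ} (hφ : IsTestFunction Ω φ) (x : E d) :
    DifferentiableAt ℝ φ x :=
  (hφ.1.differentiable (by simp)) x

theorem grad_add {φ ψ : E d → ℝ} {x : E d} (hφ : DifferentiableAt ℝ φ x)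
    (hψ : DifferentiableAt ℝ ψ x) : ∇ (φ + ψ) x = ∇ φ x + ∇ ψ x := by
  simp [gradient, fderiv_add hφ hψ]

theorem grad_smul {φ : E d → ℝ} {x : E d} (c : ℝ) (hφ : DifferentiableAt ℝ φ x) :
    ∇ (c • φ) x = c • ∇ φ x := by
  simp [gradient, fderiv_const_smul hφ c]

theorem IsTestFunction.continuous_grad {Ω : Set (E d)} {φ : E d → ℝ}
    (hφ : IsTestFunction Ω φ) : Continuous (fun x => ∇ φ x) :=
  (InnerProductSpace.toDual ℝ (E d)).symm.continuous.comp
    (hφ.1.continuous_fderiv (by simp))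

theorem IsTestFunction.memLp {Ω : Set (E d)} {φ : E d → ℝ} (hφ : IsTestFunction Ω φ) :
    MemLp φ 2 (volume.restrict Ω) :=
  (hφ.1.continuous.memLp_of_hasCompactSupport hφ.2.1).restrict Ω

theorem IsTestFunction.memLp_grad {Ω : Set (E d)} {φ : E d → ℝ} (hφ : IsTestFunction Ω φ) :
    MemLp (fun x => ∇ φ x) 2 (volume.restrict Ω) := by
  refine (hφ.continuous_grad.memLp_of_hasCompactSupport ?_).restrict Ω
  exact (hφ.2.1.fderiv (𝕜 := ℝ)).comp_left (map_zero (InnerProductSpace.toDual ℝ (E d)).symm)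

theorem memLp_coord {Ω : Set (E d)} {g : E d → E d} (hg : MemLp g 2 (volume.restrict Ω))
    (i : Fin d) : MemLp (fun x => g x i) 2 (volume.restrict Ω) :=
  (EuclideanSpace.proj (𝕜 := ℝ) i).comp_memLp' hg

theorem integrable_mul' {Ω : Set (E d)} {u v : E d → ℝ} (hu : MemLp u 2 (volume.restrict Ω))
    (hv : MemLp v 2 (volume.restrict Ω)) :
    Integrable (fun x => u x * v x) (volume.restrict Ω) :=
  hu.integrable_mul hv

theorem MemH10.zero (Ω : Set (E d)) : MemH10 Ω (0 : E d → ℝ) := by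
  refine ⟨0, ⟨MemLp.zero, MemLp.zero, ?_⟩, fun _ => 0, fun _ => IsTestFunction.zero Ω, ?_, ?_⟩
  · intro φ _ i
    simp
  · simp
  · have : ∀ x : E d, ∇ (0 : E d → ℝ) x = 0 := fun x => by simp [gradient]
    simp [this]

theorem MemH10.add {Ω : Set (E d)} {u v : E d → ℝ} (hu : MemH10 Ω u) (hv : MemH10 Ω v) :
    MemH10 Ω (u + v) := by
  obtain ⟨g, hg, φ, hφ, h1, h2⟩ := hu
  obtain ⟨k, hk, ψ, hψ, h3, h4⟩ := hv
  refine ⟨g + k, ⟨hg.memLp.add hk.memLp, hg.memLp_grad.add hk.memLp_grad, ?_⟩,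
    fun n => φ n + ψ n, fun n => (hφ n).add (hψ n), ?_, ?_⟩
  · intro χ hχ i
    have e1 : ∀ x, (u + v) x * (∇ χ x) i = u x * (∇ χ x) i + v x * (∇ χ x) i := fun x => by
      simp [add_mul]
    have e2 : ∀ x, ((g + k) x) i * χ x = g x i * χ x + k x i * χ x := fun x => by
      simp [add_mul]
    simp only [e1, e2]
    rw [integral_add (integrable_mul' hg.memLp (memLp_coord hχ.memLp_grad i))
        (integrable_mul' hk.memLp (memLp_coord hχ.memLp_grad i)),
      integral_add (integrable_mul' (memLp_coord hg.memLp_grad i) hχ.memLp)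
        (integrable_mul' (memLp_coord hk.memLp_grad i) hχ.memLp),
      hg.weak χ hχ i, hk.weak χ hχ i]
    ring
  · refine tendsto_of_tendsto_of_tendsto_of_le_of_le tendsto_const_nhds
      (by simpa using h1.add h3) (fun _ => zero_le) (fun n => ?_)
    have e : (fun x => (φ n + ψ n) x - (u + v) x)
        = (fun x => φ n x - u x) + (fun x => ψ n x - v x) := by
      funext x; simp; ring
    simp only [e]
    exact eLpNorm_add_le ((hφ n).memLp.sub hg.memLp).aestronglyMeasurable
      ((hψ n).memLp.sub hk.memLp).aestronglyMeasurable (by norm_num)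
  · refine tendsto_of_tendsto_of_tendsto_of_le_of_le tendsto_const_nhds
      (by simpa using h2.add h4) (fun _ => zero_le) (fun n => ?_)
    have e : (fun x => ∇ (φ n + ψ n) x - (g + k) x)
        = (fun x => ∇ (φ n) x - g x) + (fun x => ∇ (ψ n) x - k x) := by
      funext x
      rw [grad_add ((hφ n).diff x) ((hψ n).diff x)]
      simp only [Pi.add_apply]
      abel
    simp only [e]
    exact eLpNorm_add_le ((hφ n).memLp_grad.sub hg.memLp_grad).aestronglyMeasurable
      ((hψ n).memLp_grad.sub hk.memLp_grad).aestronglyMeasurable (by norm_num)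

theorem MemH10.smul {Ω : Set (E d)} {u : E d → ℝ} (c : ℝ) (hu : MemH10 Ω u) :
    MemH10 Ω (c • u) := by
  obtain ⟨g, hg, φ, hφ, h1, h2⟩ := hu
  have hc : ∀ {s : ℕ → ℝ≥0∞}, Tendsto s atTop (𝓝 0) →
      Tendsto (fun n => ‖c‖ₑ * s n) atTop (𝓝 0) := fun {s} hs => by
    simpa using ENNReal.Tendsto.const_mul hs (Or.inr (by simp : ‖c‖ₑ ≠ ⊤))
  refine ⟨c • g, ⟨hg.memLp.const_smul c, hg.memLp_grad.const_smul c, ?_⟩,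
    fun n => c • φ n, fun n => (hφ n).smul c, ?_, ?_⟩
  · intro χ hχ i
    have e1 : ∀ x, (c • u) x * (∇ χ x) i = c * (u x * (∇ χ x) i) := fun x => by
      simp [mul_assoc]
    have e2 : ∀ x, ((c • g) x) i * χ x = c * (g x i * χ x) := fun x => by
      simp [mul_assoc]
    simp only [e1, e2, integral_const_mul, hg.weak χ hχ i]
    ring
  · refine (hc h1).congr fun n => ?_
    rw [← eLpNorm_const_smul]
    congr 1
    funext x; simp; ring
  · refine (hc h2).congr fun n => ?_
    rw [← eLpNorm_const_smul]
    congr 1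
    funext x
    rw [grad_smul c ((hφ n).diff x)]
    simp [smul_sub]

/-- The finite element space
`V_h = {v ∈ H_0^1(Ω) ∩ C(closure Ω) : v|_K ∈ P_r(K) for every element K}`.
A function on `closure Ω` is represented by its extension by zero to `ℝ^d`. -/
def FESpace (M : SimplicialMesh d N T) (Ω : Set (E d)) (r : ℕ) : Submodule ℝ (E d → ℝ) where
  carrier := {v | (∀ x ∉ closure Ω, v x = 0) ∧ ContinuousOn v (closure Ω) ∧ MemH10 Ω v ∧
    ∀ K, ∃ p : MvPolynomial (Fin d) ℝ, p.totalDegree ≤ r ∧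
      ∀ x ∈ M.elem K, v x = MvPolynomial.eval x.ofLp p}
  zero_mem' := ⟨fun _ _ => rfl, continuousOn_const, MemH10.zero Ω,
    fun _ => ⟨0, by simp, by simp⟩⟩
  add_mem' := by
    rintro u v ⟨h1, h2, h3, h4⟩ ⟨k1, k2, k3, k4⟩
    refine ⟨fun x hx => by simp [h1 x hx, k1 x hx], h2.add k2, h3.add k3, fun K => ?_⟩
    obtain ⟨p, hp, hp'⟩ := h4 K
    obtain ⟨q, hq, hq'⟩ := k4 K
    exact ⟨p + q, (MvPolynomial.totalDegree_add p q).trans (max_le hp hq),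
      fun x hx => by simp [hp' x hx, hq' x hx]⟩
  smul_mem' := by
    rintro c u ⟨h1, h2, h3, h4⟩
    refine ⟨fun x hx => by simp [h1 x hx], h2.const_smul c, h3.smul c, fun K => ?_⟩
    obtain ⟨p, hp, hp'⟩ := h4 K
    exact ⟨c • p, (MvPolynomial.totalDegree_smul_le c p).trans hp,
      fun x hx => by simp [hp' x hx]⟩

/-! ### The finite element problems -/

/-- The bilinear form `∫_Ω (a ∇u·∇ψ + (b·∇u) ψ + c u ψ)`. -/
def bilin (Ω : Set (E d)) (a : E d → ℝ) (b : E d → E d) (c : E d → ℝ) (u ψ : E d → ℝ) : ℝ :=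
  ∫ x in Ω, (a x * inner ℝ (∇ u x) (∇ ψ x) + inner ℝ (b x) (∇ u x) * ψ x + c x * u x * ψ x)

/-- `u` is the finite element solution on the mesh `M` of the domain `Ω`. -/
def IsFESolution (M : SimplicialMesh d N T) (Ω : Set (E d)) (r : ℕ)
    (a : E d → ℝ) (b : E d → E d) (c f : E d → ℝ) (u : E d → ℝ) : Prop :=
  u ∈ FESpace M Ω r ∧ ∀ ψ ∈ FESpace M Ω r, bilin Ω a b c u ψ = ∫ x in Ω, f x * ψ x

/-- The finite element equations on the mesh deformed up to time `t`. The finite element functions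
on the deformed mesh are those which, on each `K(t)`, equal `v ∘ F_{K(t)}⁻¹` for a `v ∈ V_h`
(the same `v` for all elements); here `v = u` for the solution and `v = ψ` for the test function,
and gradients on `K(t)` are taken with respect to the variable `y ∈ K(t)`. -/
def IsDeformedFESolution [Fintype T] (M : SimplicialMesh d N T) (Ω : Set (E d)) (r : ℕ)
    (a : E d → ℝ) (b : E d → E d) (c f : E d → ℝ) (X : E d → E d) (t : ℝ) (u : E d → ℝ) : Prop :=
  u ∈ FESpace M Ω r ∧ ∀ ψ ∈ FESpace M Ω r,
    ∑ K, bilin (M.elemAt Ω X t K) a b c (M.push Ω X t K u) (M.push Ω X t K ψ)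
      = ∑ K, (∫ y in M.elemAt Ω X t K, f y * M.push Ω X t K ψ y)

end MeshSens

end

open MeshSens

open MeshSens

/-! The affine maps K → K(t) glue together to a single deformation `flow V t`, x ↦ x + t V(x), of
the whole space. Here V = Ẋ_h is Lipschitz, affine on each element with linear part Z_K = Ė_K E_K⁻¹,
and zero off Ω because the boundary nodes stand still. For small t it is a homeomorphism that
carries Ω onto Ω and K onto K(t), so transported functions are v ∘ (flow V t)⁻¹.

Let form(t, v) be the left side on the deformed mesh, tested with the transported ψ, and load(t) the
right side. Since form is linear in v and u(t) = u_h + ∑ (U_i(t) − U_i(0)) ψ_i, the right derivative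
at 0 of form(t, u(t)) = load(t) reads bilin(u̇_h, ψ) + ∂_t form(0, u_h) = load'(0). What remains is
to differentiate form and load for a fixed v.

Two devices do this. For the load and the reaction term the integral stays on Ω and t acts through v
∘ (flow V t)⁻¹; the derivative falls on the finite element functions, and the density f or c need
only be integrable (`hasDerivAt_integral_comp_flowInv`). The diffusion and convection terms contain
gradients, which jump across faces, so they are pulled back to the fixed element. There the constant
Jacobian |det(1 + tZ)| yields tr Z = div V, the pulled-back gradients (1 + tZᵀ)⁻¹∇v yield −Zᵀ∇v, and
the moving coefficient a ∘ flow V t yields ∇a·V.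

The last point is the analytic core (`hasDerivAt_integral_comp_flow`), as a has only a weak
gradient. Against a test function, a change of variables moves t from a to the test function, and
integration by parts moves the derivative back. Restarting the deformation at time s gives this at
all small times. Cutoffs and the bound on the weak gradient then reach smooth weights that do not
vanish on the element boundary, by uniform convergence of the derivatives. -/

namespace MeshSens

noncomputable section

open scoped NNReal InnerProductSpace

variable {d : ℕ}

/-! ### The deformation `x ↦ x + t V x` of a Lipschitz vector field -/

/-- The deformation of the identity by the vector field `V`. -/
def flow (V : E d → E d) (t : ℝ) (x : E d) : E d := x + t • V x

/-- The inverse of `flow V t`. -/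
def flowInv (V : E d → E d) (t : ℝ) : E d → E d := Function.invFun (flow V t)

section Flow

variable {V : E d → E d} {L : ℝ≥0} {t : ℝ}

theorem flow_zero (V : E d → E d) : flow V 0 = id := by
  funext x; simp [flow]

/-- The perturbation t V of the identity has Lipschitz constant |t| L. This is the input of the
quantitative inverse function theorem, which gives a global homeomorphism once |t| L < 1. -/
theorem approximatesLinearOn_flow (hV : LipschitzWith L V) (t : ℝ) :
    ApproximatesLinearOn (flow V t) (ContinuousLinearEquiv.refl ℝ (E d) : E d →L[ℝ] E d) univ
      (‖t‖₊ * L) := by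
  intro x _ y _
  have h := hV.dist_le_mul x y
  rw [dist_eq_norm, dist_eq_norm] at h
  have : flow V t x - flow V t y - (x - y) = t • (V x - V y) := by
    simp only [flow, smul_sub]; abel
  simp only [ContinuousLinearEquiv.coe_refl, ContinuousLinearMap.id_apply]
  rw [this, norm_smul]
  calc ‖t‖ * ‖V x - V y‖ ≤ ‖t‖ * (L * ‖x - y‖) := by gcongr
    _ = _ := by push_cast; ring

/-- For small `t` the deformation is a homeomorphism. -/
theorem exists_homeomorph_flow (hV : LipschitzWith L V) (ht : |t| * L < 1) :
    ∃ Φ : E d ≃ₜ E d, ⇑Φ = flow V t := by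
  refine ⟨ApproximatesLinearOn.toHomeomorph (flow V t) (approximatesLinearOn_flow hV t) ?_, rfl⟩
  rcases subsingleton_or_nontrivial (E d) with h | h
  · exact Or.inl h
  · right
    have : ‖((ContinuousLinearEquiv.refl ℝ (E d)).symm : E d →L[ℝ] E d)‖₊ = 1 := by
      ext; simp
    rw [this, inv_one, ← NNReal.coe_lt_coe]
    simpa using ht

theorem flow_injective (hV : LipschitzWith L V) (ht : |t| * L < 1) :
    Function.Injective (flow V t) := by
  obtain ⟨Φ, hΦ⟩ := exists_homeomorph_flow hV ht
  exact hΦ ▸ Φ.injective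

theorem flow_surjective (hV : LipschitzWith L V) (ht : |t| * L < 1) :
    Function.Surjective (flow V t) := by
  obtain ⟨Φ, hΦ⟩ := exists_homeomorph_flow hV ht
  exact hΦ ▸ Φ.surjective

theorem flowInv_flow (hV : LipschitzWith L V) (ht : |t| * L < 1) (x : E d) :
    flowInv V t (flow V t x) = x :=
  Function.leftInverse_invFun (flow_injective hV ht) x

theorem flow_flowInv (hV : LipschitzWith L V) (ht : |t| * L < 1) (x : E d) :
    flow V t (flowInv V t x) = x :=
  Function.rightInverse_invFun (flow_surjective hV ht) x

theorem flowInv_eq_sub (hV : LipschitzWith L V) (ht : |t| * L < 1) (x : E d) :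
    flowInv V t x = x - t • V (flowInv V t x) := by
  have := flow_flowInv hV ht x
  rw [flow] at this
  exact eq_sub_of_add_eq this

theorem isOpen_flow_image (hV : LipschitzWith L V) (ht : |t| * L < 1) {S : Set (E d)}
    (hS : IsOpen S) : IsOpen (flow V t '' S) := by
  obtain ⟨Φ, hΦ⟩ := exists_homeomorph_flow hV ht
  exact hΦ ▸ Φ.isOpenMap S hS

/-- In the fixed point equation of `flowInv_eq_sub` the term with t V absorbs at most half of the
difference; the constant is 1 / (1 − 1/2). -/
theorem flowInv_lipschitz (hV : LipschitzWith L V) (ht : |t| * L ≤ 1 / 2) :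
    LipschitzWith 2 (flowInv V t) := by
  have ht' : |t| * L < 1 := by linarith
  refine LipschitzWith.of_dist_le_mul fun x y => ?_
  have hx := flowInv_eq_sub hV ht' x
  have hy := flowInv_eq_sub hV ht' y
  have h := hV.dist_le_mul (flowInv V t x) (flowInv V t y)
  rw [dist_eq_norm, dist_eq_norm] at *
  have h1 : flowInv V t x - flowInv V t y
      = (x - y) - t • (V (flowInv V t x) - V (flowInv V t y)) := by
    rw [smul_sub]
    nth_rw 1 [hx]; nth_rw 1 [hy]
    abel
  have h2 : ‖flowInv V t x - flowInv V t y‖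
      ≤ ‖x - y‖ + |t| * (L * ‖flowInv V t x - flowInv V t y‖) := by
    nth_rw 1 [h1]
    refine (norm_sub_le _ _).trans ?_
    rw [norm_smul, Real.norm_eq_abs]
    gcongr
  have h3 : |t| * (L * ‖flowInv V t x - flowInv V t y‖)
      ≤ 1 / 2 * ‖flowInv V t x - flowInv V t y‖ := by
    rw [← mul_assoc]; gcongr
  push_cast
  linarith

variable {Ω : Set (E d)}

theorem flow_eq_self (hV0 : ∀ x ∉ Ω, V x = 0) {x : E d} (hx : x ∉ Ω) : flow V t x = x := by
  simp [flow, hV0 x hx]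

/-- Points outside Ω are fixed, so injectivity forbids a point of Ω to land on one of them. -/
theorem flow_mem (hV : LipschitzWith L V) (hV0 : ∀ x ∉ Ω, V x = 0) (ht : |t| * L < 1)
    {x : E d} (hx : x ∈ Ω) : flow V t x ∈ Ω := by
  by_contra h
  have h1 : flow V t (flow V t x) = flow V t x := flow_eq_self hV0 h
  rw [flow_injective hV ht h1] at h
  exact h hx

theorem flowInv_mem (hV : LipschitzWith L V) (hV0 : ∀ x ∉ Ω, V x = 0) (ht : |t| * L < 1)
    {x : E d} (hx : x ∈ Ω) : flowInv V t x ∈ Ω := by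
  by_contra h
  have h1 : flow V t (flowInv V t x) = flowInv V t x := flow_eq_self hV0 h
  rw [flow_flowInv hV ht] at h1
  exact h (h1 ▸ hx)

/-- The points of the segment are the positions of x at the earlier times θ t. No convexity of Ω is
needed. -/
theorem segment_flow_subset (hV : LipschitzWith L V) (hV0 : ∀ x ∉ Ω, V x = 0) (ht : |t| * L < 1)
    {x : E d} (hx : x ∈ Ω) : segment ℝ x (flow V t x) ⊆ Ω := by
  rw [segment_eq_image']
  rintro _ ⟨θ, hθ, rfl⟩
  have : x + θ • (flow V t x - x) = flow V (θ * t) x := by simp [flow, smul_smul]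
  simp only [this]
  refine flow_mem hV hV0 ?_ hx
  rw [abs_mul, abs_of_nonneg hθ.1]
  have : 0 ≤ |t| * L := by positivity
  nlinarith [hθ.2]

/-- Lipschitz continuity of V suffices: the remainder is t (V(flowInv y) − V y), and the second
factor is itself O(t). -/
theorem hasDerivAt_flowInv (hV : LipschitzWith L V) (y : E d) :
    HasDerivAt (fun t => flowInv V t y) (-V y) 0 := by
  have hL : ∀ᶠ t : ℝ in 𝓝 0, |t| * L < 1 / 2 :=
    (by fun_prop : Continuous fun t : ℝ => |t| * (L : ℝ)).continuousAt.eventually_lt_const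
      (by norm_num)
  have h0 : flowInv V 0 y = y := by
    simpa [flow_zero] using flow_flowInv hV (t := 0) (by simp) y
  rw [hasDerivAt_iff_isLittleO, Asymptotics.isLittleO_iff]
  intro ε hε
  have hε' : ∀ᶠ t : ℝ in 𝓝 0, |t| * (2 * L * ‖V y‖) < ε :=
    (by fun_prop : Continuous fun t : ℝ => |t| * (2 * (L : ℝ) * ‖V y‖)).continuousAt.eventually_lt_const
      (by simpa using hε)
  filter_upwards [hL, hε'] with t ht hε
  have e := flowInv_eq_sub hV (by linarith : |t| * L < 1) y
  have h := hV.dist_le_mul (flowInv V t y) y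
  rw [dist_eq_norm, dist_eq_norm] at h
  have e1 : flowInv V t y - y = -(t • V (flowInv V t y)) := by nth_rw 1 [e]; abel
  rw [e1, norm_neg, norm_smul, Real.norm_eq_abs] at h
  have h2 : ‖V (flowInv V t y)‖ ≤ ‖V y‖ + ‖V (flowInv V t y) - V y‖ := by
    have := norm_add_le (V y) (V (flowInv V t y) - V y)
    simpa using this
  -- Half of the left side is absorbed through |t| L < 1/2, which is where the factor 2 comes from.
  have h3 : ‖V (flowInv V t y) - V y‖ ≤ |t| * (2 * L * ‖V y‖) := by
    have hL0 : 0 ≤ (L : ℝ) * |t| := by positivity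
    have : (L : ℝ) * (|t| * ‖V (flowInv V t y)‖)
        ≤ L * |t| * ‖V y‖ + 1 / 2 * ‖V (flowInv V t y) - V y‖ := by
      rw [← mul_assoc]
      calc (L : ℝ) * |t| * ‖V (flowInv V t y)‖
          ≤ L * |t| * (‖V y‖ + ‖V (flowInv V t y) - V y‖) := by gcongr
        _ = L * |t| * ‖V y‖ + |t| * L * ‖V (flowInv V t y) - V y‖ := by ring
        _ ≤ _ := by gcongr
    nlinarith
  rw [h0, e1]
  have e2 : -(t • V (flowInv V t y)) - (t - 0) • -V y = -(t • (V (flowInv V t y) - V y)) := by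
    simp [smul_sub]; abel
  rw [e2, norm_neg, norm_smul, sub_zero, Real.norm_eq_abs, mul_comm]
  gcongr
  linarith

/-- The derivative at `t = 0` of `∫ f (w ∘ flowInv V t)`. -/
theorem hasDerivAt_integral_comp_flowInv (hΩ : MeasurableSet Ω) (hV : LipschitzWith L V)
    (hV0 : ∀ x ∉ Ω, V x = 0) {f w : E d → ℝ} (hf : IntegrableOn f Ω) (hw : ContinuousOn w Ω)
    (hfw : IntegrableOn (fun x => f x * w x) Ω)
    {C : ℝ} (hC : ∀ t : ℝ, |t| * L < 1 → ∀ x ∈ Ω, |w (flow V t x) - w x| ≤ C * |t|)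
    (hwd : ∀ᵐ x ∂(volume.restrict Ω), DifferentiableAt ℝ w x) :
    HasDerivAt (fun t => ∫ y in Ω, f y * w (flowInv V t y))
      (-∫ y in Ω, f y * inner ℝ (∇ w y) (V y)) 0 := by
  have h0 : ∀ y, flowInv V 0 y = y := fun y => by
    simpa [flow_zero] using flow_flowInv hV (t := 0) (by simp) y
  have hs : {t : ℝ | |t| * L < 1 / 2} ∈ 𝓝 (0 : ℝ) :=
    (by fun_prop : Continuous fun t : ℝ => |t| * (L : ℝ)).continuousAt.eventually_lt_const
      (by norm_num)
  -- Only w is differentiated. This form of dominated differentiation compares times t with time 0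
  -- only, which is what `hC` controls.
  have key := hasFDerivAt_integral_of_dominated_loc_of_lip' (μ := volume.restrict Ω) (𝕜 := ℝ)
    (F := fun t y => f y * w (flowInv V t y)) (x₀ := (0 : ℝ)) (bound := fun y => |f y| * C)
    (F' := fun y => ContinuousLinearMap.toSpanSingleton ℝ (f y * (fderiv ℝ w y (-V y)))) hs
    ?_ ?_ ?_ ?_ ?_ ?_
  · have h2 := key.2.hasDerivAt
    convert! h2 using 1
    rw [(ContinuousLinearMap.integral_apply key.1 1), ← integral_neg]
    congr 1
    funext y
    simp [gradient]
  · intro t ht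
    refine hf.aestronglyMeasurable.mul ?_
    refine ContinuousOn.aestronglyMeasurable (hw.comp ?_ ?_) hΩ
    · exact (flowInv_lipschitz hV (le_of_lt ht)).continuous.continuousOn
    · exact fun y hy => flowInv_mem hV hV0 (lt_trans (show |t| * L < 1 / 2 from ht) (by norm_num)) hy
  · simp only [h0]; exact hfw
  · have h1 : AEStronglyMeasurable (fun y => f y * fderiv ℝ w y (-V y)) (volume.restrict Ω) := by
      refine hf.aestronglyMeasurable.mul ?_
      have : Measurable fun y => fderiv ℝ w y (-V y) :=
        isBoundedBilinearMap_apply.continuous.measurable.comp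
          ((measurable_fderiv ℝ w).prodMk hV.continuous.neg.measurable)
      exact this.aestronglyMeasurable
    exact (ContinuousLinearMap.toSpanSingletonCLE (𝕜 := ℝ) (E := ℝ)).continuous.comp_aestronglyMeasurable h1
  · filter_upwards [ae_restrict_mem hΩ] with y hy t ht
    have ht' : |t| * L < 1 := lt_trans (show |t| * L < 1 / 2 from ht) (by norm_num)
    -- With x = flowInv y the increment w(flowInv y) − w(y) is w(x) − w(flow x).
    have := hC t ht' _ (flowInv_mem hV hV0 ht' hy)
    rw [flow_flowInv hV ht'] at this
    rw [h0, ← mul_sub, norm_mul, Real.norm_eq_abs, Real.norm_eq_abs, Real.norm_eq_abs, abs_sub_comm,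
      sub_zero, mul_assoc]
    gcongr
  · exact hf.norm.mul_const C
  · filter_upwards [hwd] with y hy
    have h1 := (hy.hasFDerivAt.comp_hasDerivAt_of_eq (0 : ℝ) (hasDerivAt_flowInv hV y) (h0 y).symm)
    exact (h1.const_mul (f y)).hasFDerivAt

end Flow

/-! ### Coordinates of the gradient, and the derivative of the determinant -/

theorem gradient_apply (φ : E d → ℝ) (x : E d) (i : Fin d) :
    ∇ φ x i = fderiv ℝ φ x (EuclideanSpace.single i 1) := by
  have := InnerProductSpace.toDual_symm_apply (𝕜 := ℝ) (y := fderiv ℝ φ x)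
    (x := EuclideanSpace.single i 1)
  rw [← this, gradient, EuclideanSpace.inner_single_right]; simp

/-- The trace of a linear map, computed in the standard basis. -/
def traceE (Z : E d →L[ℝ] E d) : ℝ := ∑ i, Z (EuclideanSpace.single i 1) i

theorem det_one_add_zero_smul (Z : E d →L[ℝ] E d) : (1 + (0 : ℝ) • Z).det = 1 := by
  have : 1 + (0 : ℝ) • Z = 1 := by ext; simp
  rw [this]; exact LinearMap.det_id

theorem hasDerivAt_det_one_add_smul (Z : E d →L[ℝ] E d) :
    HasDerivAt (fun t : ℝ => (1 + t • Z).det) (traceE Z) 0 := by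
  set b := (EuclideanSpace.basisFun (Fin d) ℝ).toBasis
  set M := LinearMap.toMatrix b b (Z : E d →ₗ[ℝ] E d)
  -- The remainder of the polynomial det(1 + X M) after the constant and linear coefficients 1 and
  -- tr M are split off.
  set q := (1 + (Polynomial.X : Polynomial ℝ) • M.map ⇑Polynomial.C).det.divX.divX
  have h1 : ∀ t : ℝ, (1 + t • Z).det = 1 + M.trace * t + q.eval t * t ^ 2 := by
    intro t
    rw [← Matrix.det_one_add_smul, ContinuousLinearMap.det, ← LinearMap.det_toMatrix b]
    congr 1
    simp [M, LinearMap.toMatrix_one]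
  have h2 : M.trace = traceE Z := by
    simp [M, Matrix.trace, LinearMap.toMatrix_apply, b, traceE]
  simp only [h1]
  have h3 := (((hasDerivAt_id (0 : ℝ)).const_mul M.trace).const_add 1).add
    ((q.hasDerivAt (0 : ℝ)).mul ((hasDerivAt_id (0 : ℝ)).pow 2))
  rw [← h2]
  convert! h3 using 1
  simp

/-! ### Coefficients moved by a field that is affine on an open set S -/

section AffineFlow

variable {V : E d → E d} {L : ℝ≥0} {t : ℝ} {Ω S : Set (E d)} {Z : E d →L[ℝ] E d} {w : E d}

theorem hasFDerivWithinAt_flow (hVS : ∀ x ∈ S, V x = Z x + w) {x : E d} (hx : x ∈ S) :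
    HasFDerivWithinAt (flow V t) (1 + t • Z) S x := by
  have h : HasFDerivAt (fun x => x + t • (Z x + w)) (1 + t • Z) x :=
    (hasFDerivAt_id x).add ((Z.hasFDerivAt.add_const w).const_smul t)
  exact h.hasFDerivWithinAt.congr (fun y hy => by simp [flow, hVS y hy]) (by simp [flow, hVS x hx])

theorem integral_flow_image (hV : LipschitzWith L V) (ht : |t| * L < 1) (hS : MeasurableSet S)
    (hVS : ∀ x ∈ S, V x = Z x + w) (F : E d → ℝ) :
    ∫ y in flow V t '' S, F y = |(1 + t • Z).det| * ∫ x in S, F (flow V t x) := by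
  rw [integral_image_eq_integral_abs_det_fderiv_smul volume hS
    (fun x hx => hasFDerivWithinAt_flow hVS hx) (flow_injective hV ht).injOn]
  simp only [smul_eq_mul]
  exact integral_const_mul _ _

theorem integrableOn_comp_flow {F : Type*} [NormedAddCommGroup F] [NormedSpace ℝ F]
    (hV : LipschitzWith L V) (hV0 : ∀ x ∉ Ω, V x = 0) (ht : |t| * L < 1)
    (hS : MeasurableSet S) (hSΩ : S ⊆ Ω) (hVS : ∀ x ∈ S, V x = Z x + w)
    (hdet : (1 + t • Z).det ≠ 0) {f : E d → F} (hf : IntegrableOn f Ω) :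
    IntegrableOn (fun x => f (flow V t x)) S := by
  have h1 : IntegrableOn f (flow V t '' S) :=
    hf.mono_set (image_subset_iff.2 fun x hx => flow_mem hV hV0 ht (hSΩ hx))
  rw [integrableOn_image_iff_integrableOn_abs_det_fderiv_smul volume hS
    (fun x hx => hasFDerivWithinAt_flow hVS hx) (flow_injective hV ht).injOn] at h1
  have h2 := h1.smul (|(1 + t • Z).det|)⁻¹
  refine h2.congr (Eventually.of_forall fun x => ?_)
  simp [smul_smul, inv_mul_cancel₀ (abs_ne_zero.2 hdet)]

/-- The inverse of the affine map `x ↦ x + t (Z x + w)`. -/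
def affineInv (Z : E d →L[ℝ] E d) (w : E d) (t : ℝ) (hdet : (1 + t • Z).det ≠ 0) : E d ≃ₜ E d :=
  (Homeomorph.subRight (t • w)).trans
    ((1 + t • Z).toContinuousLinearEquivOfDetNeZero hdet).symm.toHomeomorph

theorem affineInv_apply (hdet : (1 + t • Z).det ≠ 0) (y : E d) :
    affineInv Z w t hdet y
      = ((1 + t • Z).toContinuousLinearEquivOfDetNeZero hdet).symm (y - t • w) := rfl

theorem affineInv_left (hdet : (1 + t • Z).det ≠ 0) (x : E d) :
    affineInv Z w t hdet (x + t • (Z x + w)) = x := by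
  rw [affineInv_apply, ContinuousLinearEquiv.symm_apply_eq]
  have h : (1 + t • Z).toContinuousLinearEquivOfDetNeZero hdet x = x + t • Z x := by simp
  rw [h, smul_add]
  abel

theorem affineInv_right (hdet : (1 + t • Z).det ≠ 0) (y : E d) :
    affineInv Z w t hdet y + t • (Z (affineInv Z w t hdet y) + w) = y := by
  have : affineInv Z w t hdet y + t • Z (affineInv Z w t hdet y) = y - t • w := by
    have h := ((1 + t • Z).toContinuousLinearEquivOfDetNeZero hdet).apply_symm_apply (y - t • w)
    rw [← affineInv_apply] at h
    simpa using h
  rw [smul_add, ← add_assoc, this]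
  simp

theorem contDiff_affineInv (hdet : (1 + t • Z).det ≠ 0) :
    ContDiff ℝ ∞ (affineInv Z w t hdet) :=
  ((1 + t • Z).toContinuousLinearEquivOfDetNeZero hdet).symm.contDiff.comp
    (contDiff_id.sub contDiff_const)

/-- The exceptional points of S lie in the image of a null set under `affineInv`, and differentiable
maps send null sets to null sets. -/
theorem ae_comp_flow (hV : LipschitzWith L V) (hV0 : ∀ x ∉ Ω, V x = 0) (ht : |t| * L < 1)
    (hΩ : MeasurableSet Ω) (hS : MeasurableSet S) (hSΩ : S ⊆ Ω) (hVS : ∀ x ∈ S, V x = Z x + w)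
    (hdet : (1 + t • Z).det ≠ 0) {P : E d → Prop} (hP : ∀ᵐ x ∂(volume.restrict Ω), P x) :
    ∀ᵐ x ∂(volume.restrict S), P (flow V t x) := by
  rw [ae_restrict_iff' hS]
  rw [ae_restrict_iff' hΩ] at hP
  have h := addHaar_image_eq_zero_of_differentiableOn_of_addHaar_eq_zero volume
    ((contDiff_affineInv (Z := Z) (w := w) hdet).differentiable (by simp)).differentiableOn
    (mem_ae_iff.1 hP)
  refine mem_ae_iff.2 (measure_mono_null (fun x hx => ?_) h)
  simp only [mem_compl_iff, mem_ofPred_eq, not_forall] at hx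
  obtain ⟨hxS, hx⟩ := hx
  refine ⟨flow V t x, ?_, ?_⟩
  · simp only [mem_compl_iff, mem_ofPred_eq, not_forall]
    exact ⟨flow_mem hV hV0 ht (hSΩ hxS), hx⟩
  · rw [flow, hVS x hxS, affineInv_left]

theorem IsTestFunction.eq_zero {g : E d → ℝ} (hg : IsTestFunction S g) {x : E d} (hx : x ∉ S) :
    g x = 0 :=
  image_eq_zero_of_notMem_tsupport fun h => hx (hg.2.2 h)

theorem IsTestFunction.fderiv_eq_zero {g : E d → ℝ} (hg : IsTestFunction S g) {x : E d}
    (hx : x ∉ S) : fderiv ℝ g x = 0 :=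
  image_eq_zero_of_notMem_tsupport fun h => hx (hg.2.2 (tsupport_fderiv_subset ℝ h))

theorem IsTestFunction.gradient_eq_zero {g : E d → ℝ} (hg : IsTestFunction S g) {x : E d}
    (hx : x ∉ S) : ∇ g x = 0 := by
  simp [gradient, hg.fderiv_eq_zero hx]

theorem IsTestFunction.mul_left {g q : E d → ℝ} (hg : IsTestFunction S g) (hq : ContDiff ℝ ∞ q) :
    IsTestFunction S (fun x => g x * q x) :=
  ⟨hg.1.mul hq, hg.2.1.mul_right, (tsupport_mul_subset_left).trans hg.2.2⟩

theorem IsTestFunction.integrable_mul {f g : E d → ℝ} (hf : IntegrableOn f Ω)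
    (hg : IsTestFunction S g) : IntegrableOn (fun x => f x * g x) Ω := by
  obtain ⟨C, hC⟩ := hg.2.1.exists_bound_of_continuous hg.1.continuous
  exact hf.mul_bdd hg.1.continuous.aestronglyMeasurable (Eventually.of_forall hC)

theorem IsTestFunction.integrable_inner_gradient_mul {f g : E d → ℝ} (hf : IntegrableOn f Ω)
    (hg : IsTestFunction S g) (hV : Continuous V) {C : ℝ} (hC : ∀ x, ‖V x‖ ≤ C) :
    IntegrableOn (fun x => f x * inner ℝ (∇ g x) (V x)) Ω := by
  obtain ⟨C', hC'⟩ := (hg.2.1.fderiv (𝕜 := ℝ)).exists_bound_of_continuous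
    (hg.1.continuous_fderiv (by simp))
  refine hf.mul_bdd (hg.continuous_grad.inner hV).aestronglyMeasurable
    (Eventually.of_forall fun x => ?_) (c := C' * C)
  refine (norm_inner_le_norm _ _).trans ?_
  have : ‖∇ g x‖ ≤ C' := by simpa [gradient] using hC' x
  exact mul_le_mul this (hC x) (norm_nonneg _) ((norm_nonneg _).trans this)

/-- Integration by parts against the affine field `Z x + w` times a test function. -/
theorem HasWeakGradient.integral_div {a : E d → ℝ} {Da : E d → E d}
    (hSΩ : S ⊆ Ω) (hVS : ∀ x ∈ S, V x = Z x + w) (hVc : Continuous V) {C : ℝ}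
    (hVb : ∀ x, ‖V x‖ ≤ C)
    (ha : IntegrableOn a Ω) (hDa : IntegrableOn Da Ω) (haw : HasWeakGradient Ω a Da)
    {g : E d → ℝ} (hg : IsTestFunction S g) :
    ∫ x in Ω, inner ℝ (Da x) (V x) * g x
      = -(∫ x in Ω, a x * inner ℝ (∇ g x) (V x)) - traceE Z * ∫ x in Ω, a x * g x := by
  have hq : ∀ i : Fin d, ContDiff ℝ ∞ fun x : E d => (Z x + w) i := fun i =>
    (EuclideanSpace.proj (𝕜 := ℝ) i).contDiff.comp (Z.contDiff.add contDiff_const)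
  -- V need not be smooth, but g vanishes off S, so V may be replaced by its affine expression
  -- there. The products with its coordinates are admissible in the definition of the weak gradient.
  have hφ : ∀ i : Fin d, IsTestFunction S fun x => g x * (Z x + w) i := fun i =>
    hg.mul_left (hq i)
  have hφΩ : ∀ i : Fin d, IsTestFunction Ω fun x => g x * (Z x + w) i := fun i =>
    ⟨(hφ i).1, (hφ i).2.1, (hφ i).2.2.trans hSΩ⟩
  have hgrad : ∀ x i, ∇ (fun x => g x * (Z x + w) i) x i
      = g x * Z (EuclideanSpace.single i 1) i + (Z x + w) i * ∇ g x i := by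
    intro x i
    have h1 : HasFDerivAt (fun x : E d => (Z x + w) i)
        ((EuclideanSpace.proj (𝕜 := ℝ) i).comp Z) x :=
      (EuclideanSpace.proj (𝕜 := ℝ) i).hasFDerivAt.comp x (Z.hasFDerivAt.add_const w)
    rw [gradient_apply, gradient_apply, ((hg.diff x).hasFDerivAt.fun_mul h1).fderiv]
    simp
  have hint : ∀ i, Integrable (fun x => a x * ∇ (fun x => g x * (Z x + w) i) x i)
      (volume.restrict Ω) := by
    intro i
    have h1 : Continuous fun x => ∇ (fun x => g x * (Z x + w) i) x i :=
      (EuclideanSpace.proj (𝕜 := ℝ) i).continuous.comp (hφ i).continuous_grad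
    have h2 : HasCompactSupport fun x => ∇ (fun x => g x * (Z x + w) i) x i := by
      have := (hφ i).2.1.fderiv_apply (𝕜 := ℝ) (EuclideanSpace.single i 1)
      simpa only [gradient_apply] using this
    obtain ⟨C, hC⟩ := h2.exists_bound_of_continuous h1
    exact ha.mul_bdd h1.aestronglyMeasurable (Eventually.of_forall hC)
  have hDai : ∀ i : Fin d, IntegrableOn (fun x => Da x i) Ω := fun i =>
    (EuclideanSpace.proj (𝕜 := ℝ) i).integrable_comp hDa
  have e1 : ∀ x, inner ℝ (Da x) (V x) * g x = ∑ i, Da x i * (g x * (Z x + w) i) := by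
    intro x
    by_cases hx : x ∈ S
    · rw [hVS x hx, PiLp.inner_apply, Finset.sum_mul]
      refine Finset.sum_congr rfl fun i _ => ?_
      simp; ring
    · simp [hg.eq_zero hx]
  have e2 : ∀ x, ∑ i, a x * ∇ (fun x => g x * (Z x + w) i) x i
      = a x * inner ℝ (∇ g x) (V x) + traceE Z * (a x * g x) := by
    intro x
    by_cases hx : x ∈ S
    · simp only [hgrad]
      rw [hVS x hx, PiLp.inner_apply, traceE, Finset.sum_mul, Finset.mul_sum,
        ← Finset.sum_add_distrib]
      refine Finset.sum_congr rfl fun i _ => ?_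
      simp; ring
    · simp only [hgrad]; simp [hg.eq_zero hx, hg.gradient_eq_zero hx]
  calc ∫ x in Ω, inner ℝ (Da x) (V x) * g x
      = ∫ x in Ω, ∑ i, Da x i * (g x * (Z x + w) i) := by simp only [e1]
    _ = ∑ i, ∫ x in Ω, Da x i * (g x * (Z x + w) i) :=
        integral_finsetSum _ fun i _ => (hφ i).integrable_mul (hDai i)
    _ = ∑ i, -∫ x in Ω, a x * ∇ (fun x => g x * (Z x + w) i) x i := by
        refine Finset.sum_congr rfl fun i _ => ?_
        rw [haw _ (hφΩ i) i, neg_neg]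
    _ = -∫ x in Ω, ∑ i, a x * ∇ (fun x => g x * (Z x + w) i) x i := by
        rw [integral_finsetSum _ fun i _ => hint i, Finset.sum_neg_distrib]
    _ = -∫ x in Ω, (a x * inner ℝ (∇ g x) (V x) + traceE Z * (a x * g x)) := by
        simp only [e2]
    _ = _ := by
        rw [integral_add (hg.integrable_inner_gradient_mul ha hVc hVb)
          ((hg.integrable_mul ha).const_mul _), integral_const_mul]
        ring

/-- Changing variables gives ∫_S (a ∘ flow) g = det(1 + tZ)⁻¹ ∫_Ω a (g ∘ flowInv), so a is no longer
composed with anything. The integral contributes −∫ a ∇g·V and the determinant −tr Z ∫ a g; by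
`HasWeakGradient.integral_div` their sum is ∫ (Da·V) g. -/
theorem hasDerivAt_integral_comp_flow_zero (hΩ : IsOpen Ω) (hV : LipschitzWith L V)
    (hV0 : ∀ x ∉ Ω, V x = 0) {C : ℝ} (hVb : ∀ x, ‖V x‖ ≤ C) (hS : IsOpen S) (hSΩ : S ⊆ Ω)
    (hVS : ∀ x ∈ S, V x = Z x + w) {a : E d → ℝ} {Da : E d → E d}
    (ha : IntegrableOn a Ω) (hDa : IntegrableOn Da Ω) (haw : HasWeakGradient Ω a Da)
    {g : E d → ℝ} (hg : IsTestFunction S g) :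
    HasDerivAt (fun t => ∫ x in S, a (flow V t x) * g x)
      (∫ x in S, inner ℝ (Da x) (V x) * g x) 0 := by
  obtain ⟨G, hG⟩ := hg.1.lipschitzWith_of_hasCompactSupport hg.2.1 (by simp)
  have hk := hasDerivAt_integral_comp_flowInv hΩ.measurableSet hV hV0 ha
    hg.1.continuous.continuousOn (hg.integrable_mul ha) (C := G * C)
    (fun t _ x _ => by
      have := hG.dist_le_mul (flow V t x) x
      rw [Real.dist_eq, dist_eq_norm] at this
      refine this.trans ?_
      simp only [flow, add_sub_cancel_left, norm_smul, Real.norm_eq_abs]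
      rw [mul_assoc, mul_comm |t|]
      gcongr
      exact hVb x) (Eventually.of_forall hg.diff)
  have hdet := hasDerivAt_det_one_add_smul Z
  have hdet0 := det_one_add_zero_smul Z
  have hpos : ∀ᶠ t : ℝ in 𝓝 0, 0 < (1 + t • Z).det :=
    hdet.continuousAt.eventually_const_lt (by simp [hdet0])
  have hsmall : ∀ᶠ t : ℝ in 𝓝 0, |t| * L < 1 :=
    (by fun_prop : Continuous fun t : ℝ => |t| * (L : ℝ)).continuousAt.eventually_lt_const
      (by norm_num)
  have hquot := hk.div hdet (by simp [hdet0])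
  have e0 : ∀ y, flowInv V 0 y = y := fun y => by
    simpa [flow_zero] using flow_flowInv hV (t := 0) (by simp) y
  have hval : ∫ x in S, inner ℝ (Da x) (V x) * g x
      = ∫ x in Ω, inner ℝ (Da x) (V x) * g x :=
    (setIntegral_eq_of_subset_of_forall_sdiff_eq_zero hΩ.measurableSet hSΩ
      fun x hx => by simp [hg.eq_zero hx.2]).symm
  rw [hval, haw.integral_div hSΩ hVS hV.continuous hVb ha hDa hg]
  refine (hquot.congr_of_eventuallyEq ?_).congr_deriv ?_
  · filter_upwards [hpos, hsmall] with t ht ht'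
    have h1 : ∫ y in Ω, a y * g (flowInv V t y)
        = ∫ y in flow V t '' S, a y * g (flowInv V t y) := by
      refine setIntegral_eq_of_subset_of_forall_sdiff_eq_zero hΩ.measurableSet
        (image_subset_iff.2 fun x hx => flow_mem hV hV0 ht' (hSΩ hx)) fun y hy => ?_
      rw [hg.eq_zero, mul_zero]
      intro h
      exact hy.2 ⟨_, h, flow_flowInv hV ht' y⟩
    rw [Pi.div_apply, h1, integral_flow_image hV ht' hS.measurableSet hVS, abs_of_pos ht,
      mul_div_cancel_left₀ _ ht.ne']
    simp only [flowInv_flow hV ht']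
  · simp only [hdet0, e0]
    ring

/-- The deformation is restarted at time s: flow V (t + s) is flow V s followed by the deformation
along V ∘ flowInv V s. The new field is again Lipschitz, zero off Ω and affine on the image of S, so
the result at time 0 applies to it. -/
theorem hasDerivAt_integral_comp_flow_test (hΩ : IsOpen Ω) (hV : LipschitzWith L V)
    (hV0 : ∀ x ∉ Ω, V x = 0) {C : ℝ} (hVb : ∀ x, ‖V x‖ ≤ C) (hS : IsOpen S) (hSΩ : S ⊆ Ω)
    (hVS : ∀ x ∈ S, V x = Z x + w) {a : E d → ℝ} {Da : E d → E d}
    (ha : IntegrableOn a Ω) (hDa : IntegrableOn Da Ω) (haw : HasWeakGradient Ω a Da)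
    {g : E d → ℝ} (hg : IsTestFunction S g) {s : ℝ} (hs : |s| * L ≤ 1 / 2)
    (hdet : (1 + s • Z).det ≠ 0) :
    HasDerivAt (fun t => ∫ x in S, a (flow V t x) * g x)
      (∫ x in S, inner ℝ (Da (flow V s x)) (V x) * g x) s := by
  have hs' : |s| * L < 1 := by linarith
  set A := (1 + s • Z).toContinuousLinearEquivOfDetNeZero hdet with hA
  have hinv : ∀ x ∈ S, affineInv Z w s hdet (flow V s x) = x := fun x hx => by
    rw [flow, hVS x hx, affineInv_left]
  have hflow : ∀ y, affineInv Z w s hdet y ∈ S → flow V s (affineInv Z w s hdet y) = y :=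
    fun y hy => by rw [flow, hVS _ hy, affineInv_right]
  -- The affine inverse replaces `flowInv`: both agree on the image of S, and the affine one is
  -- smooth everywhere.
  have hg' : IsTestFunction (flow V s '' S) (g ∘ affineInv Z w s hdet) := by
    refine ⟨hg.1.comp (contDiff_affineInv hdet), hg.2.1.comp_homeomorph _, ?_⟩
    rw [tsupport_comp_eq_preimage]
    intro y hy
    exact ⟨_, hg.2.2 hy, hflow y (hg.2.2 hy)⟩
  have key := hasDerivAt_integral_comp_flow_zero hΩ (V := V ∘ flowInv V s)
    -- Obtained by inserting x = A⁻¹(y − s w), with A = 1 + sZ, into Z x + w.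
    (Z := Z.comp (A.symm : E d →L[ℝ] E d)) (w := w - s • Z (A.symm w))
    (hV.comp (flowInv_lipschitz hV hs))
    (fun x hx => hV0 _ fun h => hx (by
      have := flow_mem hV hV0 hs' h
      rwa [flow_flowInv hV hs'] at this)) (fun x => hVb _) (isOpen_flow_image hV hs' hS)
    (image_subset_iff.2 fun x hx => flow_mem hV hV0 hs' (hSΩ hx))
    (by
      rintro _ ⟨x, hx, rfl⟩
      have h1 := hinv x hx
      rw [affineInv_apply, ← hA, map_sub] at h1
      have h2 : A.symm (flow V s x) = x + s • A.symm w := by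
        rw [← map_smul]; exact sub_eq_iff_eq_add.1 h1
      simp only [Function.comp_apply, flowInv_flow hV hs', ContinuousLinearMap.comp_apply,
        ContinuousLinearEquiv.coe_coe, h2, hVS x hx, map_add, map_smul]
      abel)
    ha hDa haw hg'
  have hd0 : |(1 + s • Z).det| ≠ 0 := abs_ne_zero.2 hdet
  have hcomp : ∀ t, ∀ x ∈ S, flow (V ∘ flowInv V s) t (flow V s x) = flow V (t + s) x := by
    intro t x _
    simp only [flow, Function.comp_apply, add_smul]
    rw [show x + s • V x = flow V s x from rfl, flowInv_flow hV hs']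
    simp only [flow]; abel
  simp only [integral_flow_image hV hs' hS.measurableSet hVS] at key
  have key2 := key.const_mul (|(1 + s • Z).det|)⁻¹
  simp only [← mul_assoc, inv_mul_cancel₀ hd0, one_mul] at key2
  have key3 : HasDerivAt (fun t => ∫ x in S, a (flow V (t + s) x) * g x)
      (∫ x in S, inner ℝ (Da (flow V s x)) (V x) * g x) 0 := by
    convert! key2 using 1
    · funext t
      refine setIntegral_congr_fun hS.measurableSet fun x hx => ?_
      simp only [Function.comp_apply, hinv x hx, hcomp t x hx]
    · refine setIntegral_congr_fun hS.measurableSet fun x hx => ?_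
      simp only [Function.comp_apply, hinv x hx, flowInv_flow hV hs']
  have key4 := HasDerivAt.comp_sub_const (x := s) (a := s) (by simpa using key3)
  simpa using key4

/-- Smooth cutoff functions that exhaust a bounded open set. -/
theorem exists_cutoff (hS : IsOpen S) (hSb : Bornology.IsBounded S) :
    ∃ χ : ℕ → E d → ℝ, (∀ n, IsTestFunction S (χ n)) ∧ (∀ n x, χ n x ∈ Icc (0 : ℝ) 1) ∧
      ∀ x ∈ S, Tendsto (fun n => χ n x) atTop (𝓝 1) := by
  obtain ⟨f, hf, hfs, hfr⟩ := hS.exists_contDiff_support_eq (n := ⊤)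
  -- The support lies in the closed set {n f ≥ 1}, which is contained in S since f vanishes off S.
  -- The value is 1 as soon as n f ≥ 2.
  refine ⟨fun n x => Real.smoothTransition (n * f x - 1), fun n => ?_, fun n x =>
    ⟨Real.smoothTransition.nonneg _, Real.smoothTransition.le_one _⟩, fun x hx => ?_⟩
  · have hts : tsupport (fun x => Real.smoothTransition (n * f x - 1)) ⊆ {x | 1 ≤ n * f x} := by
      refine closure_minimal (fun x hx => ?_) (isClosed_le continuous_const
        (continuous_const.mul hfs.continuous))
      by_contra h
      exact hx (Real.smoothTransition.zero_of_nonpos (by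
        simp only [mem_ofPred_eq, not_le] at h; linarith))
    have hsub : tsupport (fun x => Real.smoothTransition (n * f x - 1)) ⊆ S := by
      intro x hx
      rw [← hf, Function.mem_support]
      intro h
      have := hts hx
      simp only [mem_ofPred_eq, h, mul_zero] at this
      linarith
    refine ⟨Real.smoothTransition.contDiff.comp ((contDiff_const.mul hfs).sub contDiff_const),
      ?_, hsub⟩
    exact Metric.isCompact_of_isClosed_isBounded (isClosed_tsupport _) (hSb.subset hsub)
  · have hpos : 0 < f x := by
      have h1 : f x ≠ 0 := by rw [← Function.mem_support, hf]; exact hx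
      exact lt_of_le_of_ne (hfr ⟨x, rfl⟩).1 h1.symm
    refine tendsto_const_nhds.congr' ?_
    obtain ⟨N, hN⟩ := exists_nat_gt (2 / f x)
    filter_upwards [eventually_ge_atTop N] with n hn
    refine (Real.smoothTransition.one_of_one_le ?_).symm
    rw [div_lt_iff₀ hpos] at hN
    have : (N : ℝ) * f x ≤ n * f x := by gcongr
    linarith

/-- The weight g need not vanish near the boundary of S. It is approximated by the test functions
χ_n g, whose integrals have derivatives converging uniformly near time 0. The limit theorem for
derivatives needs them on a whole neighbourhood of 0, hence the version at a general time s. -/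
theorem hasDerivAt_integral_comp_flow (hΩ : IsOpen Ω) (hV : LipschitzWith L V)
    (hV0 : ∀ x ∉ Ω, V x = 0) {C : ℝ} (hVb : ∀ x, ‖V x‖ ≤ C) (hS : IsOpen S)
    (hSb : Bornology.IsBounded S) (hSΩ : S ⊆ Ω)
    (hVS : ∀ x ∈ S, V x = Z x + w) {a : E d → ℝ} {Da : E d → E d}
    (ha : IntegrableOn a Ω) (hDa : IntegrableOn Da Ω) (haw : HasWeakGradient Ω a Da)
    {Λ : ℝ} (hΛ : ∀ᵐ x ∂(volume.restrict Ω), ‖Da x‖ ≤ Λ)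
    {g : E d → ℝ} (hg : ContDiff ℝ ∞ g) :
    HasDerivAt (fun t => ∫ x in S, a (flow V t x) * g x)
      (∫ x in S, inner ℝ (Da x) (V x) * g x) 0 := by
  obtain ⟨χ, hχ, hχ01, hχ1⟩ := exists_cutoff hS hSb
  have hfin : volume S < ⊤ := hSb.measure_lt_top
  have : IsFiniteMeasure (volume.restrict S) := ⟨by simpa using hfin⟩
  obtain ⟨G, hG⟩ : ∃ G, ∀ x ∈ S, ‖g x‖ ≤ G := by
    obtain ⟨G, hG⟩ := hSb.isCompact_closure.exists_bound_of_continuousOn hg.continuous.continuousOn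
    exact ⟨G, fun x hx => hG x (subset_closure hx)⟩
  have hdet := (hasDerivAt_det_one_add_smul Z).continuousAt
  have hdet0 := det_one_add_zero_smul Z
  have hne : ∀ᶠ t : ℝ in 𝓝 0, (1 + t • Z).det ≠ 0 := hdet.eventually_ne (by simp [hdet0])
  have hsmall : ∀ᶠ t : ℝ in 𝓝 0, |t| * L < 1 / 2 :=
    (by fun_prop : Continuous fun t : ℝ => |t| * (L : ℝ)).continuousAt.eventually_lt_const
      (by norm_num)
  obtain ⟨U, hU, hUo, hU0⟩ := eventually_nhds_iff.1 (hne.and hsmall)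
  have hsm : ∀ t ∈ U, |t| * L < 1 := fun t ht => by linarith [(hU t ht).2]
  have hχm : ∀ n, AEStronglyMeasurable (χ n) (volume.restrict S) := fun n =>
    (hχ n).1.continuous.aestronglyMeasurable
  have hgS : ∀ᵐ x ∂(volume.restrict S), ‖g x‖ ≤ G :=
    (ae_restrict_mem hS.measurableSet).mono hG
  have hχb : ∀ n, ∀ᵐ x ∂(volume.restrict S), ‖χ n x‖ ≤ 1 := fun n =>
    Eventually.of_forall fun x => by
      rw [Real.norm_eq_abs, abs_of_nonneg (hχ01 n x).1]; exact (hχ01 n x).2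
  have hDi : ∀ s ∈ U, Integrable (fun x => inner ℝ (Da (flow V s x)) (V x) * g x)
      (volume.restrict S) := by
    intro s hs
    have h1 : Integrable (fun x => Da (flow V s x)) (volume.restrict S) :=
      integrableOn_comp_flow hV hV0 (hsm s hs) hS.measurableSet hSΩ hVS (hU s hs).1 hDa
    have h2 : Integrable (fun x => inner ℝ (Da (flow V s x)) (V x)) (volume.restrict S) := by
      refine (h1.norm.mul_const C).mono'
        (h1.aestronglyMeasurable.inner hV.continuous.aestronglyMeasurable)
        (Eventually.of_forall fun x => (norm_inner_le_norm _ _).trans ?_)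
      gcongr
      exact hVb x
    exact h2.mul_bdd hg.continuous.aestronglyMeasurable hgS
  have ha' : ∀ s ∈ U, Integrable (fun x => a (flow V s x) * g x) (volume.restrict S) :=
    fun s hs => (integrableOn_comp_flow hV hV0 (hsm s hs) hS.measurableSet hSΩ hVS (hU s hs).1
      ha).mul_bdd hg.continuous.aestronglyMeasurable hgS
  have hg'' : ∀ n, IsTestFunction S (fun x => χ n x * g x) := fun n => (hχ n).mul_left hg
  have hcut : Tendsto (fun n => ∫ x in S, (1 - χ n x)) atTop (𝓝 0) := by
    have : Tendsto (fun n => ∫ x in S, (1 - χ n x)) atTop (𝓝 (∫ x in S, (0 : ℝ))) := by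
      refine tendsto_integral_of_dominated_convergence (fun _ => 1)
        (fun n => aestronglyMeasurable_const.sub (hχm n)) (integrable_const _) (fun n => ?_) ?_
      · refine Eventually.of_forall fun x => ?_
        rw [Real.norm_eq_abs, abs_of_nonneg (by linarith [(hχ01 n x).2])]
        linarith [(hχ01 n x).1]
      · filter_upwards [ae_restrict_mem hS.measurableSet] with x hx
        simpa using (hχ1 x hx).const_sub 1
    simpa using this
  have hχi : ∀ n, Integrable (fun x => 1 - χ n x) (volume.restrict S) := fun n =>
    (integrable_const _).sub (Integrable.of_bound (hχm n) 1 (hχb n))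
  have main := hasDerivAt_of_tendstoUniformlyOn (l := atTop) (s := U) (x := (0 : ℝ))
    (f := fun n t => ∫ x in S, a (flow V t x) * (χ n x * g x))
    (f' := fun n t => ∫ x in S, inner ℝ (Da (flow V t x)) (V x) * (χ n x * g x))
    (g := fun t => ∫ x in S, a (flow V t x) * g x)
    (g' := fun t => ∫ x in S, inner ℝ (Da (flow V t x)) (V x) * g x) hUo ?_ ?_ ?_ hU0
  · simpa [flow_zero] using main
  -- A bound independent of the time s: Λ bounds Da, C bounds V and G bounds g on S.
  · have hlim : Tendsto (fun n => Λ * C * G * ∫ x in S, (1 - χ n x)) atTop (𝓝 0) := by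
      simpa using hcut.const_mul (Λ * C * G)
    rw [Metric.tendstoUniformlyOn_iff]
    intro ε hε
    filter_upwards [hlim.eventually_lt_const hε] with n hn s hs
    refine lt_of_le_of_lt ?_ hn
    have hsub : (∫ x in S, inner ℝ (Da (flow V s x)) (V x) * g x)
        - ∫ x in S, inner ℝ (Da (flow V s x)) (V x) * (χ n x * g x)
        = ∫ x in S, inner ℝ (Da (flow V s x)) (V x) * g x * (1 - χ n x) := by
      rw [← integral_sub (hDi s hs)]
      · congr 1; funext x; ring
      · refine ((hDi s hs).mul_bdd (hχm n) (hχb n)).congr (Eventually.of_forall fun x => ?_)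
        ring
    rw [dist_eq_norm, hsub, ← integral_const_mul]
    refine norm_integral_le_of_norm_le ((hχi n).const_mul _) ?_
    filter_upwards [ae_comp_flow hV hV0 (hsm s hs) hΩ.measurableSet hS.measurableSet hSΩ hVS
      (hU s hs).1 hΛ, hgS] with x hx hx'
    rw [norm_mul, norm_mul, Real.norm_of_nonneg (by linarith [(hχ01 n x).2] : 0 ≤ 1 - χ n x)]
    have h1 : ‖inner ℝ (Da (flow V s x)) (V x)‖ ≤ Λ * C :=
      (norm_inner_le_norm _ _).trans (mul_le_mul hx (hVb x) (norm_nonneg _)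
        ((norm_nonneg _).trans hx))
    refine mul_le_mul_of_nonneg_right ?_ (by linarith [(hχ01 n x).2])
    exact mul_le_mul h1 hx' (norm_nonneg _) ((norm_nonneg _).trans h1)
  · exact Eventually.of_forall fun n s hs => hasDerivAt_integral_comp_flow_test hΩ hV hV0 hVb hS
      hSΩ hVS ha hDa haw (hg'' n) (hU s hs).2.le (hU s hs).1
  · intro s hs
    refine tendsto_integral_of_dominated_convergence (fun x => ‖a (flow V s x) * g x‖)
      (fun n => ?_) (ha' s hs).norm (fun n => ?_) ?_
    · refine ((ha' s hs).aestronglyMeasurable.mul (hχm n)).congr (Eventually.of_forall fun x => ?_)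
      simp only [Pi.mul_apply]; ring
    · filter_upwards [hχb n] with x hx
      rw [show a (flow V s x) * (χ n x * g x) = a (flow V s x) * g x * χ n x by ring, norm_mul]
      exact mul_le_of_le_one_right (norm_nonneg _) hx
    · filter_upwards [ae_restrict_mem hS.measurableSet] with x hx
      simpa using ((hχ1 x hx).mul_const (g x)).const_mul (a (flow V s x))

end AffineFlow

/-! ### Functions that are Lipschitz on the pieces of a finite closed cover -/

/-- Continuous induction along the segment: the parameters up to which the estimate holds form a
closed set, and from each of them it can be continued a little to the right inside a single piece.
-/
theorem dist_le_of_finite_cover {T F G : Type*} [Finite T] [NormedAddCommGroup F] [NormedSpace ℝ F]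
    [PseudoMetricSpace G] {C : T → Set F} (hC : ∀ K, IsClosed (C K)) {f : F → G} {c : ℝ≥0}
    (hf : ∀ K, LipschitzOnWith c f (C K)) {x y : F} (hxy : segment ℝ x y ⊆ ⋃ K, C K) :
    dist (f x) (f y) ≤ c * dist x y := by
  set γ : ℝ → F := fun s => x + s • (y - x) with hγ
  have hγc : Continuous γ := by fun_prop
  have hγmem : ∀ s ∈ Icc (0 : ℝ) 1, ∃ K, γ s ∈ C K := fun s hs =>
    mem_iUnion.1 (hxy (by rw [segment_eq_image']; exact ⟨s, hs, rfl⟩))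
  have hγd : ∀ s t, s ≤ t → dist (γ s) (γ t) = (t - s) * dist x y := by
    intro s t hst
    have : γ s - γ t = (s - t) • (y - x) := by simp only [hγ, sub_smul]; abel
    rw [dist_eq_norm, this, norm_smul, dist_comm x y, dist_eq_norm, Real.norm_eq_abs,
      abs_sub_comm, abs_of_nonneg (sub_nonneg.2 hst)]
  set D : Set ℝ := {s | dist (f x) (f (γ s)) ≤ c * (s * dist x y)} with hD
  -- Continuity of f is given only piece by piece, so closedness is checked on each piece and
  -- carried over to the finite union.
  have hDeq : D ∩ Icc 0 1 = ⋃ K, (Icc 0 1 ∩ γ ⁻¹' C K) ∩ D := by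
    ext s
    simp only [mem_inter_iff, mem_iUnion, mem_preimage]
    constructor
    · rintro ⟨h1, h2⟩
      obtain ⟨K, hK⟩ := hγmem s h2
      exact ⟨K, ⟨h2, hK⟩, h1⟩
    · rintro ⟨K, ⟨h1, -⟩, h2⟩
      exact ⟨h2, h1⟩
  have hclosed : IsClosed (D ∩ Icc 0 1) := by
    rw [hDeq]
    refine isClosed_iUnion_of_finite fun K => ?_
    have h1 : IsClosed (Icc (0 : ℝ) 1 ∩ γ ⁻¹' C K) := isClosed_Icc.inter ((hC K).preimage hγc)
    have h2 : ContinuousOn (fun s => f (γ s)) (Icc (0 : ℝ) 1 ∩ γ ⁻¹' C K) :=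
      (hf K).continuousOn.comp hγc.continuousOn fun s hs => hs.2
    have h3 : ContinuousOn (fun s : ℝ => (dist (f x) (f (γ s)), (c : ℝ) * (s * dist x y)))
        (Icc (0 : ℝ) 1 ∩ γ ⁻¹' C K) :=
      (continuous_dist.comp_continuousOn (continuousOn_const.prodMk h2)).prodMk (by fun_prop)
    exact h3.preimage_isClosed_of_isClosed h1 (isClosed_le continuous_fst continuous_snd)
  have hsub : Icc (0 : ℝ) 1 ⊆ D := by
    refine IsClosed.Icc_subset_of_forall_exists_gt hclosed (by simp [hD, hγ]) ?_
    rintro s ⟨hsD, hs0, hs1⟩ b hb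
    have hev : ∀ᶠ r in 𝓝[>] s, r ∈ Ioc s b ∧ ∃ K, γ r ∈ C K := by
      filter_upwards [Ioc_mem_nhdsGT hb, Ioc_mem_nhdsGT hs1] with r hr hr1
      exact ⟨hr, hγmem r ⟨hs0.trans hr1.1.le, hr1.2⟩⟩
    -- With finitely many pieces, one of them is met arbitrarily close to the right of s; being
    -- closed, it contains γ s as well.
    obtain ⟨K, hK⟩ : ∃ K, ∃ᶠ r in 𝓝[>] s, r ∈ Ioc s b ∧ γ r ∈ C K := by
      by_contra h
      simp only [not_exists, not_frequently] at h
      have h' := eventually_all.2 h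
      obtain ⟨r, hr, hr'⟩ := (hev.and h').exists
      obtain ⟨K, hK⟩ := hr.2
      exact hr' K ⟨hr.1, hK⟩
    have hsK : γ s ∈ C K := by
      have h1 : s ∈ closure (γ ⁻¹' C K) := by
        rw [mem_closure_iff_frequently]
        exact (hK.filter_mono nhdsWithin_le_nhds).mono fun r hr => hr.2
      rwa [((hC K).preimage hγc).closure_eq] at h1
    obtain ⟨r, hr, hrK⟩ := hK.exists
    refine ⟨r, ?_, hr⟩
    have h1 := (hf K).dist_le_mul _ hsK _ hrK
    rw [hγd s r hr.1.le] at h1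
    have h2 : dist (f x) (f (γ s)) ≤ c * (s * dist x y) := hsD
    have h3 := dist_triangle (f x) (f (γ s)) (f (γ r))
    change dist (f x) (f (γ r)) ≤ c * (r * dist x y)
    linarith
  have h1 : dist (f x) (f (γ 1)) ≤ c * (1 * dist x y) := hsub (by simp)
  simpa [hγ] using h1

/-! ### Barycentric coordinates -/

theorem mulE_eq (A : Matrix (Fin d) (Fin d) ℝ) (x : E d) :
    mulE A x = Matrix.toEuclideanCLM (𝕜 := ℝ) A x := rfl

theorem mulE_mul (A B : Matrix (Fin d) (Fin d) ℝ) (x : E d) :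
    mulE (A * B) x = mulE A (mulE B x) := by
  simp [mulE_eq]

/-- The barycentric coordinates as affine maps. -/
def lagrangeAff (p : Fin (d + 1) → E d) (j : Fin (d + 1)) : E d →ᵃ[ℝ] ℝ :=
  let B : E d →ₗ[ℝ] E d := (Matrix.toEuclideanCLM (𝕜 := ℝ) (edgeMatrix p)⁻¹ : E d →L[ℝ] E d)
  let c : Fin d → (E d →ᵃ[ℝ] ℝ) := fun k =>
    ((EuclideanSpace.proj (𝕜 := ℝ) k : E d →L[ℝ] ℝ).toLinearMap ∘ₗ B).toAffineMap -
      AffineMap.const ℝ (E d) (B (p 0) k)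
  Fin.cases (AffineMap.const ℝ (E d) 1 - ∑ k, c k) c j

theorem lagrange_succ (p : Fin (d + 1) → E d) (k : Fin d) (x : E d) :
    lagrange p k.succ x = mulE (edgeMatrix p)⁻¹ (x - p 0) k := rfl

theorem lagrange_zero (p : Fin (d + 1) → E d) (x : E d) :
    lagrange p 0 x = 1 - ∑ k : Fin d, lagrange p k.succ x := rfl

theorem affineMap_sum_apply {ι F G : Type*} [AddCommGroup F] [Module ℝ F] [AddCommGroup G]
    [Module ℝ G] (s : Finset ι) (f : ι → F →ᵃ[ℝ] G) (x : F) : (∑ i ∈ s, f i) x = ∑ i ∈ s, f i x := by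
  classical
  induction s using Finset.induction_on with
  | empty => simp
  | insert j s hj ih => simp [Finset.sum_insert hj, ih]

theorem lagrangeAff_apply (p : Fin (d + 1) → E d) (j : Fin (d + 1)) (x : E d) :
    lagrangeAff p j x = lagrange p j x := by
  refine Fin.cases ?_ (fun k => ?_) j
  · simp [lagrangeAff, lagrange, mulE_eq, affineMap_sum_apply]
  · simp [lagrangeAff, lagrange, mulE_eq]

theorem edgeMatrix_mulVec (q : Fin (d + 1) → E d) (y : E d) :
    mulE (edgeMatrix q) y = ∑ k : Fin d, y k • (q k.succ - q 0) := by
  ext i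
  simp [mulE, edgeMatrix, Matrix.mulVec, dotProduct, mul_comm]

/-- Used with q the moved vertices, the nodal velocities, or p itself; all three are interpolated by
the same barycentric coordinates. -/
theorem sum_lagrange_smul (p q : Fin (d + 1) → E d) (x : E d) :
    ∑ j, lagrange p j x • q j = elementMap p q x := by
  rw [Fin.sum_univ_succ, lagrange_zero, elementMap, mulE_mul, edgeMatrix_mulVec]
  simp only [lagrange_succ, smul_sub, Finset.sum_sub_distrib, sub_smul, one_smul, Finset.sum_smul]
  abel

theorem elementMap_self {p : Fin (d + 1) → E d} (hp : (edgeMatrix p).det ≠ 0) (x : E d) :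
    elementMap p p x = x := by
  rw [elementMap, Matrix.mul_nonsing_inv _ (isUnit_iff_ne_zero.2 hp)]
  simp [mulE_eq]

theorem elementMap_elementMap {p q : Fin (d + 1) → E d} (hq : (edgeMatrix q).det ≠ 0)
    (hp : (edgeMatrix p).det ≠ 0) (x : E d) : elementMap q p (elementMap p q x) = x := by
  refine Eq.trans ?_ (elementMap_self hp x)
  simp only [elementMap, add_sub_cancel_left]
  rw [← mulE_mul, Matrix.mul_assoc, Matrix.nonsing_inv_mul_cancel_left _ _ (isUnit_iff_ne_zero.2 hq)]

open Classical in
theorem lagrange_vertex {p : Fin (d + 1) → E d} (hp : (edgeMatrix p).det ≠ 0)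
    (j k : Fin (d + 1)) : lagrange p j (p k) = if j = k then 1 else 0 := by
  have hsucc : ∀ (i : Fin d) (k : Fin (d + 1)),
      lagrange p i.succ (p k) = if i.succ = k then 1 else 0 := by
    intro i k
    rw [lagrange_succ]
    refine Fin.cases ?_ (fun k => ?_) k
    · simp [mulE_eq, Fin.succ_ne_zero]
    · have h : p k.succ - p 0 = mulE (edgeMatrix p) (EuclideanSpace.single k 1) := by
        rw [edgeMatrix_mulVec]; simp [ite_smul]
      rw [h, ← mulE_mul, Matrix.nonsing_inv_mul _ (isUnit_iff_ne_zero.2 hp)]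
      simp [mulE_eq]
  refine Fin.cases ?_ (fun i => hsucc i k) j
  rw [lagrange_zero]
  simp only [hsucc]
  refine Fin.cases ?_ (fun k => ?_) k
  · simp [Fin.succ_ne_zero]
  · simp [(Fin.succ_ne_zero _).symm]

theorem lagrange_eq_zero_of_mem_face {p : Fin (d + 1) → E d} (hp : (edgeMatrix p).det ≠ 0)
    {s : Set (Fin (d + 1))} {j : Fin (d + 1)} (hj : j ∉ s) {x : E d}
    (hx : x ∈ convexHull ℝ (p '' s)) : lagrange p j x = 0 := by
  have hconv : Convex ℝ (lagrangeAff p j ⁻¹' {0}) := (convex_singleton 0).affine_preimage _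
  have h := convexHull_min (t := lagrangeAff p j ⁻¹' {0}) ?_ hconv hx
  · simpa [lagrangeAff_apply] using h
  · rintro _ ⟨k, hk, rfl⟩
    simp [lagrangeAff_apply, lagrange_vertex hp, show j ≠ k from fun h => hj (h ▸ hk)]

/-- The zero set is an affine subspace, and it misses the vertex p_j. -/
theorem volume_lagrange_eq_zero {p : Fin (d + 1) → E d} (hp : (edgeMatrix p).det ≠ 0)
    (j : Fin (d + 1)) : volume {x | lagrange p j x = 0} = 0 := by
  have h := Measure.addHaar_affineSubspace volume
    ((affineSpan ℝ {(0 : ℝ)}).comap (lagrangeAff p j)) ?_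
  · convert h using 2
    ext x
    simp [lagrangeAff_apply]
  · intro h
    have : p j ∈ (affineSpan ℝ {(0 : ℝ)}).comap (lagrangeAff p j) := by rw [h]; trivial
    simp [AffineSubspace.mem_comap, lagrangeAff_apply, lagrange_vertex hp] at this

/-- `elementMap` as an affine map. -/
def elementAff (p q : Fin (d + 1) → E d) : E d →ᵃ[ℝ] E d :=
  AffineMap.const ℝ (E d) (q 0) +
    ((Matrix.toEuclideanCLM (𝕜 := ℝ) (edgeMatrix q * (edgeMatrix p)⁻¹) :
      E d →L[ℝ] E d).toLinearMap.toAffineMap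
      - AffineMap.const ℝ (E d) (mulE (edgeMatrix q * (edgeMatrix p)⁻¹) (p 0)))

theorem elementAff_apply (p q : Fin (d + 1) → E d) (x : E d) :
    elementAff p q x = elementMap p q x := by
  simp [elementAff, elementMap, mulE_eq]

theorem elementMap_vertex {p : Fin (d + 1) → E d} (hp : (edgeMatrix p).det ≠ 0)
    (q : Fin (d + 1) → E d) (k : Fin (d + 1)) : elementMap p q (p k) = q k := by
  rw [← sum_lagrange_smul]
  simp [lagrange_vertex hp]

theorem elementMap_image_convexHull {p : Fin (d + 1) → E d} (hp : (edgeMatrix p).det ≠ 0)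
    (q : Fin (d + 1) → E d) :
    elementMap p q '' convexHull ℝ (range p) = convexHull ℝ (range q) := by
  have h : elementMap p q = elementAff p q := funext fun x => (elementAff_apply p q x).symm
  rw [h, AffineMap.image_convexHull, ← range_comp]
  congr 2
  funext k
  simp [elementAff_apply, elementMap_vertex hp]

/-! ### The piecewise linear velocity field of a mesh -/

namespace SimplicialMesh

variable {N T : Type*} (M : SimplicialMesh d N T) {Ω : Set (E d)}

theorem det_vert (K : T) : (edgeMatrix (M.vert K)).det ≠ 0 := M.nondegenerate K

theorem isCompact_elem (K : T) : IsCompact (M.elem K) :=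
  (finite_range _).isCompact_convexHull ℝ

theorem isClosed_elem (K : T) : IsClosed (M.elem K) := (M.isCompact_elem K).isClosed

theorem convex_elem (K : T) : Convex ℝ (M.elem K) := convex_convexHull ℝ _

open Classical in
-- The affine expressions attached to K and to the chosen element agree at the common vertices,
-- hence on their convex hull, which contains x by conformity.
theorem hat_eq {K : T} {x : E d} (hx : x ∈ M.elem K) (i : N) :
    M.hat i x = ∑ j, if M.conn K j = i then lagrange (M.vert K) j x else 0 := by
  have hex : ∃ K, x ∈ M.elem K := ⟨K, hx⟩
  rw [hat, dif_pos hex]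
  set L := hex.choose
  let a : T → (E d →ᵃ[ℝ] ℝ) := fun K =>
    ∑ j, if M.conn K j = i then lagrangeAff (M.vert K) j else 0
  have ha : ∀ K x, a K x = ∑ j, if M.conn K j = i then lagrange (M.vert K) j x else 0 := by
    intro K x
    rw [affineMap_sum_apply]
    refine Finset.sum_congr rfl fun j _ => ?_
    split_ifs <;> simp [lagrangeAff_apply]
  have hv : ∀ K (k : Fin (d + 1)), a K (M.pos (M.conn K k)) = if M.conn K k = i then 1 else 0 := by
    intro K k
    rw [ha, show M.pos (M.conn K k) = M.vert K k from rfl, Finset.sum_eq_single k]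
    · simp [lagrange_vertex (M.det_vert K)]
    · intro j _ hj
      simp [lagrange_vertex (M.det_vert K), hj]
    · simp
  have hconv : Convex ℝ ((a L - a K) ⁻¹' {0}) := (convex_singleton 0).affine_preimage _
  have h := convexHull_min (t := (a L - a K) ⁻¹' {0}) ?_ hconv
    (M.conforming K L ⟨hx, hex.choose_spec⟩)
  · rw [← ha, ← ha]
    simpa [sub_eq_zero] using h
  · rintro _ ⟨_, ⟨⟨k, rfl⟩, ⟨l, hl⟩⟩, rfl⟩
    have h1 := hv L l
    rw [hl] at h1
    simp [hv K k, h1]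

/-- The gradient of the velocity field on the element `K`. -/
def velGrad (Ω : Set (E d)) (X : E d → E d) (K : T) : E d →L[ℝ] E d :=
  Matrix.toEuclideanCLM (𝕜 := ℝ) (M.edgeVel Ω X K * (M.edge K)⁻¹)

/-- The constant part of the velocity field on the element `K`. -/
def velConst (Ω : Set (E d)) (X : E d → E d) (K : T) : E d :=
  M.nodeVel Ω X (M.conn K 0) - M.velGrad Ω X K (M.vert K 0)

variable (X : E d → E d)

theorem velInterp_eq_sum [Fintype N] {K : T} {x : E d} (hx : x ∈ M.elem K) :
    M.velInterp Ω X x = ∑ j, lagrange (M.vert K) j x • M.nodeVel Ω X (M.conn K j) := by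
  classical
  simp only [velInterp, M.hat_eq hx, Finset.sum_smul]
  rw [Finset.sum_comm]
  refine Finset.sum_congr rfl fun j _ => ?_
  simp [ite_smul]

theorem velInterp_eq_affine [Fintype N] {K : T} {x : E d} (hx : x ∈ M.elem K) :
    M.velInterp Ω X x = M.velGrad Ω X K x + M.velConst Ω X K := by
  rw [M.velInterp_eq_sum X hx, sum_lagrange_smul, elementMap, velConst, velGrad, mulE_eq, map_sub]
  simp only [edgeVel, edge]
  abel

/-- A boundary point lies in a face contained in the boundary. The vertices of that face do not
move, and the coordinates of the other vertices vanish on it. Off the closure no element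
contributes. -/
theorem velInterp_eq_zero [Fintype N] (hM : M.IsMeshOf Ω) : ∀ x ∉ Ω, M.velInterp Ω X x = 0 := by
  intro x hx
  by_cases hcl : x ∈ closure Ω
  · have hfr : x ∈ frontier Ω := ⟨hcl, by rwa [hM.isOpen.interior_eq]⟩
    obtain ⟨K, s, hxs, hs⟩ := hM.boundary x hfr
    have hxK : x ∈ M.elem K := convexHull_mono (image_subset_range _ _) hxs
    rw [M.velInterp_eq_sum X hxK]
    refine Finset.sum_eq_zero fun j _ => ?_
    by_cases hj : j ∈ s
    · have h1 : M.vert K j ∈ frontier Ω := hs (subset_convexHull ℝ _ ⟨j, hj, rfl⟩)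
      have h2 : M.pos (M.conn K j) ∉ Ω := fun h => by
        have := h1.2
        rw [hM.isOpen.interior_eq] at this
        exact this h
      simp [nodeVel, h2]
    · rw [lagrange_eq_zero_of_mem_face (M.det_vert K) hj hxs, zero_smul]
  · have h : ¬ ∃ K, x ∈ M.elem K := by
      rintro ⟨K, hK⟩
      exact hcl (hM.cover ▸ mem_iUnion.2 ⟨K, hK⟩)
    simp [velInterp, hat, h]

theorem exists_lipschitzWith_velInterp [Fintype N] [Finite T]
    (hM : M.IsMeshOf Ω) :
    ∃ L : ℝ≥0, LipschitzWith L (M.velInterp Ω X) := by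
  have := Fintype.ofFinite T
  refine ⟨∑ K, ‖M.velGrad Ω X K‖₊, LipschitzWith.of_dist_le_mul fun x y => ?_⟩
  -- Adding the closed set Ωᶜ, where V = 0, as the piece `none` makes the cover one of the whole
  -- space, so every segment is admissible.
  refine dist_le_of_finite_cover (T := Option T) (C := fun o => o.elim Ωᶜ M.elem) ?_ ?_ ?_
  · rintro (_ | K)
    · exact hM.isOpen.isClosed_compl
    · exact M.isClosed_elem K
  · rintro (_ | K)
    · refine LipschitzOnWith.of_dist_le_mul fun x hx y hy => ?_
      rw [M.velInterp_eq_zero X hM x hx, M.velInterp_eq_zero X hM y hy, dist_self]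
      positivity
    · refine LipschitzOnWith.of_dist_le_mul fun x hx y hy => ?_
      rw [M.velInterp_eq_affine X hx, M.velInterp_eq_affine X hy, dist_add_right]
      refine ((M.velGrad Ω X K).lipschitz.dist_le_mul x y).trans ?_
      gcongr
      exact Finset.single_le_sum (f := fun K => ‖M.velGrad Ω X K‖₊) (fun _ _ => zero_le)
        (Finset.mem_univ K)
  · intro z _
    by_cases hz : z ∈ Ω
    · have : z ∈ ⋃ K, M.elem K := hM.cover ▸ subset_closure hz
      obtain ⟨K, hK⟩ := mem_iUnion.1 this
      exact mem_iUnion.2 ⟨some K, hK⟩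
    · exact mem_iUnion.2 ⟨none, hz⟩

theorem isBounded_of_isMeshOf [Finite T] (hM : M.IsMeshOf Ω) : Bornology.IsBounded Ω := by
  have : IsCompact (closure Ω) := hM.cover ▸ isCompact_iUnion M.isCompact_elem
  exact this.isBounded.subset subset_closure

theorem exists_norm_velInterp_le [Fintype N] [Finite T]
    (hM : M.IsMeshOf Ω) :
    ∃ C : ℝ, ∀ x, ‖M.velInterp Ω X x‖ ≤ C := by
  obtain ⟨L, hL⟩ := M.exists_lipschitzWith_velInterp X hM
  obtain ⟨C, hC⟩ := (M.isBounded_of_isMeshOf hM).isCompact_closure.exists_bound_of_continuousOn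
    hL.continuous.continuousOn
  refine ⟨max C 0, fun x => ?_⟩
  by_cases hx : x ∈ Ω
  · exact (hC x (subset_closure hx)).trans (le_max_left _ _)
  · simp [M.velInterp_eq_zero X hM x hx]

/-! ### The deformed elements -/

theorem edgeMatrix_vertAt (t : ℝ) (K : T) :
    edgeMatrix (M.vertAt Ω X t K) = M.edge K + t • M.edgeVel Ω X K := by
  ext i j
  simp [edgeMatrix, vertAt, edge, edgeVel]
  ring

/-- Barycentric coordinates reproduce both x and V(x). This identifies the separate element maps
with one global deformation. -/
theorem elementMap_vertAt_eq_flow [Fintype N] (t : ℝ) {K : T} {x : E d} (hx : x ∈ M.elem K) :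
    elementMap (M.vert K) (M.vertAt Ω X t K) x = flow (M.velInterp Ω X) t x := by
  rw [flow, M.velInterp_eq_sum X hx, Finset.smul_sum]
  nth_rw 2 [← elementMap_self (M.det_vert K) x]
  rw [← sum_lagrange_smul, ← sum_lagrange_smul,
    ← Finset.sum_add_distrib]
  refine Finset.sum_congr rfl fun j _ => ?_
  rw [vertAt, smul_add, smul_comm]

theorem elemAt_eq_image [Fintype N] (t : ℝ) (K : T) :
    M.elemAt Ω X t K = flow (M.velInterp Ω X) t '' M.elem K := by
  rw [elemAt, ← elementMap_image_convexHull (M.det_vert K) (M.vertAt Ω X t K)]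
  exact image_congr fun x hx => M.elementMap_vertAt_eq_flow X t hx

/-- From E_K + tĖ_K = (1 + tĖ_K E_K⁻¹) E_K. Hence K(t) is nondegenerate exactly when det(1 + tZ_K) ≠
0. -/
theorem det_edgeMatrix_vertAt (t : ℝ) (K : T) :
    (edgeMatrix (M.vertAt Ω X t K)).det = (1 + t • M.velGrad Ω X K).det * (M.edge K).det := by
  have hE : IsUnit (M.edge K).det := isUnit_iff_ne_zero.2 (M.det_vert K)
  have h1 : M.edge K + t • M.edgeVel Ω X K
      = (1 + t • (M.edgeVel Ω X K * (M.edge K)⁻¹)) * M.edge K := by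
    rw [add_mul, one_mul, smul_mul_assoc, Matrix.nonsing_inv_mul_cancel_right _ _ hE]
  rw [edgeMatrix_vertAt, h1, Matrix.det_mul]
  congr 1
  have h2 : 1 + t • M.velGrad Ω X K
      = Matrix.toEuclideanCLM (𝕜 := ℝ) (1 + t • (M.edgeVel Ω X K * (M.edge K)⁻¹)) := by
    simp [velGrad]
  rw [h2, ContinuousLinearMap.det,
    ← LinearMap.det_toMatrix (EuclideanSpace.basisFun (Fin d) ℝ).toBasis]
  congr 1
  ext i j
  simp [LinearMap.toMatrix_apply, Matrix.one_apply, Matrix.mul_apply, Matrix.mulVec, dotProduct]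

theorem elementMap_flow [Fintype N] {t : ℝ} {K : T} (hdet : (1 + t • M.velGrad Ω X K).det ≠ 0) {x : E d}
    (hx : x ∈ M.elem K) :
    elementMap (M.vertAt Ω X t K) (M.vert K) (flow (M.velInterp Ω X) t x) = x := by
  rw [← M.elementMap_vertAt_eq_flow X t hx]
  refine elementMap_elementMap ?_ (M.det_vert K) x
  rw [det_edgeMatrix_vertAt]
  exact mul_ne_zero hdet (M.det_vert K)

/-! ### The open pieces of the domain -/

/-- The interior of the element `K` (the part in `Ω`). -/
def piece (Ω : Set (E d)) (K : T) : Set (E d) := interior (M.elem K) ∩ Ω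

theorem isOpen_piece (hΩ : IsOpen Ω) (K : T) : IsOpen (M.piece Ω K) := isOpen_interior.inter hΩ

theorem piece_subset_elem (K : T) : M.piece Ω K ⊆ M.elem K :=
  inter_subset_left.trans interior_subset

/-- Distinct elements differ in a vertex. By conformity they meet in the span of the common
vertices, where the barycentric coordinate of that vertex is zero. -/
theorem volume_elem_inter {K L : T} (h : K ≠ L) : volume (M.elem K ∩ M.elem L) = 0 := by
  have key : ∀ K L : T, ∀ j, M.conn K j ∉ range (M.conn L) →
      volume (M.elem K ∩ M.elem L) = 0 := by
    intro K L j hj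
    refine measure_mono_null (fun x hx => ?_) (volume_lagrange_eq_zero (M.det_vert K) j)
    have h1 : M.pos '' (range (M.conn K) ∩ range (M.conn L))
        ⊆ (M.pos ∘ M.conn K) '' {k | M.conn K k ∈ range (M.conn L)} := by
      rintro _ ⟨_, ⟨⟨k, rfl⟩, hk⟩, rfl⟩
      exact ⟨k, hk, rfl⟩
    exact lagrange_eq_zero_of_mem_face (M.det_vert K) (j := j) hj
      (convexHull_mono h1 (M.conforming K L hx))
  by_cases h1 : ∃ j, M.conn K j ∉ range (M.conn L)
  · obtain ⟨j, hj⟩ := h1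
    exact key K L j hj
  · by_cases h2 : ∃ j, M.conn L j ∉ range (M.conn K)
    · obtain ⟨j, hj⟩ := h2
      rw [inter_comm]
      exact key L K j hj
    · push Not at h1 h2
      exact absurd (M.distinct K L (Subset.antisymm (range_subset_iff.2 h1)
        (range_subset_iff.2 h2))) h

theorem volume_frontier [Finite T] (hM : M.IsMeshOf Ω) : volume (frontier Ω) = 0 := by
  have hint : interior (frontier Ω) = ∅ := by
    rw [← frontier_compl]
    exact interior_frontier hM.isOpen.isClosed_compl
  have hsub : frontier Ω ⊆ ⋃ (K : T), ⋃ (s : Set (Fin (d + 1))),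
      {x | x ∈ convexHull ℝ (M.vert K '' s) ∧ convexHull ℝ (M.vert K '' s) ⊆ frontier Ω} := by
    intro x hx
    obtain ⟨K, s, h⟩ := hM.boundary x hx
    exact mem_iUnion.2 ⟨K, mem_iUnion.2 ⟨s, h⟩⟩
  refine measure_mono_null hsub ?_
  rw [measure_iUnion_null_iff]
  intro K
  rw [measure_iUnion_null_iff]
  intro s
  by_cases hs : convexHull ℝ (M.vert K '' s) ⊆ frontier Ω
  -- The frontier of an open set has empty interior, so a convex hull inside it lies in its own
  -- frontier, which is null by convexity.
  · refine measure_mono_null (fun x hx => ?_)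
      ((convex_convexHull ℝ (M.vert K '' s)).addHaar_frontier volume)
    refine ⟨subset_closure hx.1, fun h => ?_⟩
    have : x ∈ interior (frontier Ω) := interior_mono hs h
    rw [hint] at this
    exact this
  · simp [hs]

theorem volume_elem_diff_piece [Finite T] (hM : M.IsMeshOf Ω) (K : T) :
    volume (M.elem K \ M.piece Ω K) = 0 := by
  refine measure_mono_null (t := frontier (M.elem K) ∪ frontier Ω) (fun x hx => ?_)
    (measure_union_null ((M.convex_elem K).addHaar_frontier volume) (M.volume_frontier hM))
  by_cases h : x ∈ interior (M.elem K)
  · right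
    refine ⟨hM.cover ▸ mem_iUnion.2 ⟨K, hx.1⟩, fun h' => hx.2 ⟨h, interior_subset h'⟩⟩
  · exact Or.inl ⟨subset_closure hx.1, h⟩

/-- The intersection is open and null, hence empty. -/
theorem disjoint_piece (hΩ : IsOpen Ω) {K L : T} (h : K ≠ L) :
    Disjoint (M.piece Ω K) (M.piece Ω L) := by
  rw [Set.disjoint_iff_inter_eq_empty]
  refine (((M.isOpen_piece hΩ K).inter (M.isOpen_piece hΩ L)).measure_eq_zero_iff volume).1 ?_
  exact measure_mono_null (inter_subset_inter (M.piece_subset_elem K) (M.piece_subset_elem L))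
    (M.volume_elem_inter h)

/-! ### Splitting integrals over Ω into deformed pieces -/

section Measure

variable {L : ℝ≥0} {t : ℝ}

theorem volume_flow_image [Fintype N] {K : T} {s : Set (E d)} (hs : s ⊆ M.elem K) (h0 : volume s = 0) :
    volume (flow (M.velInterp Ω X) t '' s) = 0 :=
  addHaar_image_eq_zero_of_differentiableOn_of_addHaar_eq_zero volume
    (fun _ hx => ((hasFDerivWithinAt_flow (S := M.elem K)
      (fun _ hy => M.velInterp_eq_affine X hy) (hs hx)).differentiableWithinAt).mono hs) h0

theorem elemAt_ae_eq [Fintype N] [Finite T] (hM : M.IsMeshOf Ω) (K : T) :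
    M.elemAt Ω X t K =ᵐ[volume] flow (M.velInterp Ω X) t '' M.piece Ω K := by
  rw [elemAt_eq_image]
  refine (ae_eq_set).2 ⟨?_, ?_⟩
  · refine measure_mono_null
      (t := flow (M.velInterp Ω X) t '' (M.elem K \ M.piece Ω K)) ?_
      (M.volume_flow_image X sdiff_subset (M.volume_elem_diff_piece hM K))
    rintro _ ⟨⟨x, hx, rfl⟩, h⟩
    exact ⟨x, ⟨hx, fun h' => h ⟨x, h', rfl⟩⟩, rfl⟩
  · rw [sdiff_eq_empty.2 (image_mono (M.piece_subset_elem K)), measure_empty]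

/-- An integral over the domain is the sum of the integrals over the deformed elements. -/
theorem sum_integral_flow_image [Fintype N] [Fintype T] (hM : M.IsMeshOf Ω) (hV : LipschitzWith L (M.velInterp Ω X))
    (ht : |t| * L < 1) {F : E d → ℝ} (hF : IntegrableOn F Ω) :
    ∑ K, ∫ y in flow (M.velInterp Ω X) t '' M.piece Ω K, F y = ∫ y in Ω, F y := by
  have hV0 := M.velInterp_eq_zero X hM
  have hsub : ∀ K, flow (M.velInterp Ω X) t '' M.piece Ω K ⊆ Ω := fun K =>
    image_subset_iff.2 fun x hx => flow_mem hV hV0 ht hx.2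
  rw [← integral_iUnion_fintype]
  · refine setIntegral_congr_set (ae_eq_set.2 ⟨?_, ?_⟩)
    · rw [sdiff_eq_empty.2 (iUnion_subset hsub), measure_empty]
    -- A point missed by the moved pieces comes from a point of Ω in no element interior, that is,
    -- from the boundary of some element.
    · have h : Ω \ ⋃ K, flow (M.velInterp Ω X) t '' M.piece Ω K
          ⊆ ⋃ K, flow (M.velInterp Ω X) t '' frontier (M.elem K) := by
        rintro y ⟨hy, hy'⟩
        have hx := flowInv_mem hV hV0 ht hy
        obtain ⟨K, hK⟩ := mem_iUnion.1 (hM.cover ▸ subset_closure hx)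
        refine mem_iUnion.2 ⟨K, _, ⟨subset_closure hK, fun h => ?_⟩, flow_flowInv hV ht y⟩
        exact hy' (mem_iUnion.2 ⟨K, _, ⟨h, hx⟩, flow_flowInv hV ht y⟩)
      refine measure_mono_null h (measure_iUnion_null fun K => ?_)
      exact M.volume_flow_image X (M.isClosed_elem K).frontier_subset
        ((M.convex_elem K).addHaar_frontier volume)
  · exact fun K => (isOpen_flow_image hV ht (M.isOpen_piece hM.isOpen K)).measurableSet
  · intro K K' h
    exact disjoint_image_of_injective (flow_injective hV ht) (M.disjoint_piece hM.isOpen h)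
  · exact fun K => hF.mono_set (hsub K)

theorem sum_integral_piece [Fintype N] [Fintype T] (hM : M.IsMeshOf Ω) {F : E d → ℝ} (hF : IntegrableOn F Ω) :
    ∑ K, ∫ y in M.piece Ω K, F y = ∫ y in Ω, F y := by
  obtain ⟨L, hL⟩ := M.exists_lipschitzWith_velInterp (Ω := Ω) 0 hM
  simpa [flow_zero] using M.sum_integral_flow_image 0 hM hL (t := 0) (by simp) hF

theorem ae_restrict_of_piece [Finite T] (hM : M.IsMeshOf Ω) {P : E d → Prop}
    (hP : ∀ K, ∀ x ∈ M.piece Ω K, P x) : ∀ᵐ x ∂(volume.restrict Ω), P x := by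
  rw [ae_restrict_iff' hM.isOpen.measurableSet]
  have h : volume (⋃ K, frontier (M.elem K)) = 0 :=
    measure_iUnion_null fun K => (M.convex_elem K).addHaar_frontier volume
  refine mem_ae_iff.2 (measure_mono_null (fun x hx => ?_) h)
  simp only [mem_compl_iff, mem_ofPred_eq, not_forall] at hx
  obtain ⟨hx, hx'⟩ := hx
  obtain ⟨K, hK⟩ := mem_iUnion.1 (hM.cover ▸ subset_closure hx)
  exact mem_iUnion.2 ⟨K, subset_closure hK, fun h => hx' (hP K x ⟨h, hx⟩)⟩

end Measure

end SimplicialMesh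

/-! ### Derivatives of integrals over a deformed element -/

theorem hasDerivAt_inverse_one_add_smul (W : E d →L[ℝ] E d) :
    HasDerivAt (fun t : ℝ => Ring.inverse (1 + t • W)) (-W) 0 := by
  have h1 : HasDerivAt (fun t : ℝ => 1 + t • W) W 0 := by
    simpa using ((hasDerivAt_id (0 : ℝ)).smul_const W).const_add 1
  have h2 := hasFDerivAt_ringInverse (𝕜 := ℝ) (1 : (E d →L[ℝ] E d)ˣ)
  have h3 := h2.comp_hasDerivAt_of_eq (0 : ℝ) h1 (by ext; simp)
  convert! h3 using 1

theorem sum_smul_single (p : E d) : ∑ k, p k • EuclideanSpace.single k (1 : ℝ) = p := by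
  ext i
  simp [Pi.single_apply]

/-- Separates variables: with R and S depending on t only, and p and q on x only, the time
dependence becomes scalar factors that leave the integral. -/
theorem inner_map_map_eq_sum (R S : E d →L[ℝ] E d) (p q : E d) :
    ⟪R p, S q⟫_ℝ = ∑ k, ∑ l, ⟪R (EuclideanSpace.single k 1), S (EuclideanSpace.single l 1)⟫_ℝ
      * (p k * q l) := by
  conv_lhs => rw [← sum_smul_single p, ← sum_smul_single q]
  simp only [map_sum, map_smul, sum_inner, inner_sum, real_inner_smul_left, real_inner_smul_right]
  rw [Finset.sum_comm]
  refine Finset.sum_congr rfl fun k _ => Finset.sum_congr rfl fun l _ => ?_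
  ring

theorem inner_map_eq_sum (S : E d →L[ℝ] E d) (p q : E d) :
    ⟪p, S q⟫_ℝ = ∑ k, ∑ l, S (EuclideanSpace.single l 1) k * (p k * q l) := by
  have h := inner_map_map_eq_sum 1 S p q
  simpa [EuclideanSpace.inner_single_left] using h

theorem contDiff_gradient_apply {p : E d → ℝ} (hp : ContDiff ℝ ∞ p) (k : Fin d) :
    ContDiff ℝ ∞ fun x => ∇ p x k := by
  simp only [gradient_apply]
  exact (hp.fderiv_right (m := ∞) (by simp)).clm_apply contDiff_const

theorem continuous_gradient {p : E d → ℝ} (hp : ContDiff ℝ ∞ p) : Continuous (∇ p) :=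
  (InnerProductSpace.toDual ℝ (E d)).symm.continuous.comp (hp.continuous_fderiv (by simp))

section Element

variable {V : E d → E d} {L : ℝ≥0} {Ω S : Set (E d)} {Z : E d →L[ℝ] E d} {w : E d}

theorem hasDerivAt_abs_det (Z : E d →L[ℝ] E d) :
    HasDerivAt (fun t : ℝ => |(1 + t • Z).det|) (traceE Z) 0 := by
  have h := hasDerivAt_det_one_add_smul Z
  refine h.congr_of_eventuallyEq ?_
  filter_upwards [h.continuousAt.eventually_const_lt
    (by simp [det_one_add_zero_smul] : (0 : ℝ) < _)] with t ht
  exact abs_of_pos ht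

theorem eventually_det_ne_zero (Z : E d →L[ℝ] E d) :
    ∀ᶠ t : ℝ in 𝓝 0, (1 + t • Z).det ≠ 0 :=
  (hasDerivAt_det_one_add_smul Z).continuousAt.eventually_ne (by simp [det_one_add_zero_smul])

theorem eventually_abs_mul_lt_one (L : ℝ≥0) : ∀ᶠ t : ℝ in 𝓝 0, |t| * L < 1 :=
  (by fun_prop : Continuous fun t : ℝ => |t| * (L : ℝ)).continuousAt.eventually_lt_const
    (by norm_num)

theorem integrableOn_mul_of_continuous {a g : E d → ℝ} (hS : MeasurableSet S)
    (hSb : Bornology.IsBounded S) (ha : IntegrableOn a S) (hg : Continuous g) :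
    IntegrableOn (fun x => a x * g x) S := by
  obtain ⟨G, hG⟩ := hSb.isCompact_closure.exists_bound_of_continuousOn hg.continuousOn
  exact ha.mul_bdd hg.aestronglyMeasurable
    ((ae_restrict_mem hS).mono fun x hx => hG x (subset_closure hx))

theorem integrableOn_inner_of_continuous {F g : E d → E d} (hS : MeasurableSet S)
    (hSb : Bornology.IsBounded S) (hF : IntegrableOn F S) (hg : Continuous g) :
    IntegrableOn (fun x => ⟪F x, g x⟫_ℝ) S := by
  obtain ⟨G, hG⟩ := hSb.isCompact_closure.exists_bound_of_continuousOn hg.continuousOn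
  refine (hF.norm.mul_const G).mono' (hF.aestronglyMeasurable.inner hg.aestronglyMeasurable) ?_
  filter_upwards [ae_restrict_mem hS] with x hx
  refine (norm_inner_le_norm _ _).trans ?_
  gcongr
  exact hG x (subset_closure hx)

/-- The derivative of a linear combination of integrals with moving coefficients. -/
theorem hasDerivAt_sum_integral_comp_flow {J : Type*} [Fintype J] (hΩ : IsOpen Ω)
    (hV : LipschitzWith L V) (hV0 : ∀ x ∉ Ω, V x = 0) {C : ℝ} (hVb : ∀ x, ‖V x‖ ≤ C)
    (hS : IsOpen S) (hSb : Bornology.IsBounded S) (hSΩ : S ⊆ Ω) (hVS : ∀ x ∈ S, V x = Z x + w)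
    {a : J → E d → ℝ} {Da : J → E d → E d}
    (ha : ∀ j, IntegrableOn (a j) Ω) (hDa : ∀ j, IntegrableOn (Da j) Ω)
    (haw : ∀ j, HasWeakGradient Ω (a j) (Da j))
    {Λ : J → ℝ} (hΛ : ∀ j, ∀ᵐ x ∂(volume.restrict Ω), ‖Da j x‖ ≤ Λ j)
    {g : J → E d → ℝ} (hg : ∀ j, ContDiff ℝ ∞ (g j)) {σ : J → ℝ → ℝ} {σ' : J → ℝ}
    (hσ : ∀ j, HasDerivAt (σ j) (σ' j) 0) :
    HasDerivAt (fun t => ∫ x in S, ∑ j, σ j t * (a j (flow V t x) * g j x))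
      (∫ x in S, ∑ j, (σ j 0 * (⟪Da j x, V x⟫_ℝ * g j x) + σ' j * (a j x * g j x))) 0 := by
  have hSm := hS.measurableSet
  have hSi : ∀ j, IntegrableOn (fun x => a j x * g j x) S := fun j =>
    integrableOn_mul_of_continuous hSm hSb ((ha j).mono_set hSΩ) (hg j).continuous
  have hSD : ∀ j, IntegrableOn (fun x => ⟪Da j x, V x⟫_ℝ * g j x) S := fun j =>
    integrableOn_mul_of_continuous hSm hSb
      (integrableOn_inner_of_continuous hSm hSb ((hDa j).mono_set hSΩ) hV.continuous)
      (hg j).continuous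
  have h := HasDerivAt.fun_sum (u := Finset.univ) fun j _ => (hσ j).mul
    (hasDerivAt_integral_comp_flow hΩ hV hV0 hVb hS hSb hSΩ hVS (ha j) (hDa j) (haw j) (hΛ j) (hg j))
  refine (h.congr_of_eventuallyEq ?_).congr_deriv ?_
  · filter_upwards [eventually_det_ne_zero Z, eventually_abs_mul_lt_one L] with t hdet ht
    rw [integral_finsetSum]
    · refine Finset.sum_congr rfl fun j _ => ?_
      rw [integral_const_mul]; rfl
    · intro j _
      exact (integrableOn_mul_of_continuous hSm hSb
        (integrableOn_comp_flow hV hV0 ht hSm hSΩ hVS hdet (ha j)) (hg j).continuous).const_mul _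
  · rw [integral_finsetSum]
    · refine Finset.sum_congr rfl fun j _ => ?_
      rw [integral_add ((hSD j).const_mul _) ((hSi j).const_mul _), integral_const_mul,
        integral_const_mul]
      simp only [flow_zero, id_eq]
      ring
    · exact fun j _ => ((hSD j).const_mul _).add ((hSi j).const_mul _)

/-- Three time-dependent factors are differentiated: the determinant gives tr Z, the moving
coefficient gives Da·V, and each inverse gives −Z*. The integrability statements allow the terms to
be summed over the elements afterwards. -/
theorem hasDerivAt_diffusion (hΩ : IsOpen Ω)
    (hV : LipschitzWith L V) (hV0 : ∀ x ∉ Ω, V x = 0) {C : ℝ} (hVb : ∀ x, ‖V x‖ ≤ C)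
    (hS : IsOpen S) (hSb : Bornology.IsBounded S) (hSΩ : S ⊆ Ω) (hVS : ∀ x ∈ S, V x = Z x + w)
    {a : E d → ℝ} {Da : E d → E d} (ha : IntegrableOn a Ω) (hDa : IntegrableOn Da Ω)
    (haw : HasWeakGradient Ω a Da) {Λ : ℝ} (hΛ : ∀ᵐ x ∂(volume.restrict Ω), ‖Da x‖ ≤ Λ)
    {p q : E d → ℝ} (hp : ContDiff ℝ ∞ p) (hq : ContDiff ℝ ∞ q) :
    IntegrableOn (fun x => ⟪Da x, V x⟫_ℝ * ⟪∇ p x, ∇ q x⟫_ℝ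
      + a x * ⟪∇ p x, ∇ q x⟫_ℝ * traceE Z) S ∧
    IntegrableOn (fun x => a x * ⟪∇ p x, (Z + star Z) (∇ q x)⟫_ℝ) S ∧
    HasDerivAt (fun t => |(1 + t • Z).det| * ∫ x in S, a (flow V t x) *
        ⟪Ring.inverse (1 + t • star Z) (∇ p x), Ring.inverse (1 + t • star Z) (∇ q x)⟫_ℝ)
      ((∫ x in S, (⟪Da x, V x⟫_ℝ * ⟪∇ p x, ∇ q x⟫_ℝ + a x * ⟪∇ p x, ∇ q x⟫_ℝ * traceE Z))
        - ∫ x in S, a x * ⟪∇ p x, (Z + star Z) (∇ q x)⟫_ℝ) 0 := by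
  have hG : ∀ e : E d, HasDerivAt (fun t : ℝ => Ring.inverse (1 + t • star Z) e) (-(star Z e)) 0 :=
    fun e => by
      simpa using (hasDerivAt_inverse_one_add_smul (star Z)).clm_apply (hasDerivAt_const (0 : ℝ) e)
  have hG0 : ∀ e : E d, Ring.inverse (1 + (0 : ℝ) • star Z) e = e := fun e => by
    have : 1 + (0 : ℝ) • star Z = 1 := by ext; simp
    rw [this, Ring.inverse_one]; rfl
  let e : Fin d → E d := fun k => EuclideanSpace.single k 1
  have hσ : ∀ j : Fin d × Fin d, HasDerivAt (fun t : ℝ => |(1 + t • Z).det| *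
      ⟪Ring.inverse (1 + t • star Z) (e j.1), Ring.inverse (1 + t • star Z) (e j.2)⟫_ℝ)
      (traceE Z * ⟪e j.1, e j.2⟫_ℝ - (⟪e j.1, star Z (e j.2)⟫_ℝ + ⟪star Z (e j.1), e j.2⟫_ℝ)) 0 := by
    intro j
    refine ((hasDerivAt_abs_det Z).mul ((hG (e j.1)).inner ℝ (hG (e j.2)))).congr_deriv ?_
    simp only [hG0, det_one_add_zero_smul, abs_one, inner_neg_left, inner_neg_right]
    ring
  have key := hasDerivAt_sum_integral_comp_flow hΩ hV hV0 hVb hS hSb hSΩ hVS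
    (a := fun _ : Fin d × Fin d => a) (Da := fun _ => Da) (fun _ => ha) (fun _ => hDa)
    (fun _ => haw) (fun _ => hΛ) (g := fun j x => ∇ p x j.1 * ∇ q x j.2)
    (fun j => (contDiff_gradient_apply hp j.1).mul (contDiff_gradient_apply hq j.2)) hσ
  have hSm := hS.measurableSet
  have hpq : Continuous fun x => ⟪∇ p x, ∇ q x⟫_ℝ :=
    (continuous_gradient hp).inner (continuous_gradient hq)
  have haS := ha.mono_set hSΩ
  have i1 := integrableOn_mul_of_continuous hSm hSb haS hpq
  have i2 := integrableOn_mul_of_continuous hSm hSb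
    (integrableOn_inner_of_continuous hSm hSb (hDa.mono_set hSΩ) hV.continuous) hpq
  have i12 : IntegrableOn (fun x => ⟪Da x, V x⟫_ℝ * ⟪∇ p x, ∇ q x⟫_ℝ
      + a x * ⟪∇ p x, ∇ q x⟫_ℝ * traceE Z) S := i2.add (i1.mul_const _)
  have i3 : IntegrableOn (fun x => a x * ⟪∇ p x, (Z + star Z) (∇ q x)⟫_ℝ) S :=
    integrableOn_mul_of_continuous hSm hSb haS ((continuous_gradient hp).inner ((Z + star Z).continuous.comp (continuous_gradient hq)))
  refine ⟨i12, i3, (key.congr_of_eventuallyEq (Eventually.of_forall fun t => ?_)).congr_deriv ?_⟩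
  · simp only
    rw [← integral_const_mul]
    congr 1
    funext x
    rw [inner_map_map_eq_sum, Fintype.sum_prod_type, Finset.mul_sum, Finset.mul_sum]
    refine Finset.sum_congr rfl fun k _ => ?_
    rw [Finset.mul_sum, Finset.mul_sum]
    refine Finset.sum_congr rfl fun l _ => ?_
    ring
  · rw [← integral_sub i12 i3]
    congr 1
    funext x
    have h1 : ⟪∇ p x, ∇ q x⟫_ℝ = ∑ j : Fin d × Fin d, ⟪e j.1, e j.2⟫_ℝ * (∇ p x j.1 * ∇ q x j.2) := by
      have := inner_map_map_eq_sum 1 1 (∇ p x) (∇ q x)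
      rw [Fintype.sum_prod_type]
      exact this
    have h2 : ⟪∇ p x, (Z + star Z) (∇ q x)⟫_ℝ = ∑ j : Fin d × Fin d,
        (⟪e j.1, star Z (e j.2)⟫_ℝ + ⟪star Z (e j.1), e j.2⟫_ℝ) * (∇ p x j.1 * ∇ q x j.2) := by
      have h3 := inner_map_map_eq_sum 1 (star Z) (∇ p x) (∇ q x)
      have h4 := inner_map_map_eq_sum (star Z) 1 (∇ p x) (∇ q x)
      -- The adjoint falling on the first gradient is moved to the second as Z, which produces the
      -- symmetric sum Z + Z*.
      have h5 : ⟪∇ p x, Z (∇ q x)⟫_ℝ = ⟪star Z (∇ p x), ∇ q x⟫_ℝ := by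
        rw [ContinuousLinearMap.star_eq_adjoint, ContinuousLinearMap.adjoint_inner_left]
      rw [Fintype.sum_prod_type, add_apply, inner_add_right, h5]
      simp only [add_mul, Finset.sum_add_distrib]
      rw [add_comm]
      exact congrArg₂ _ h3 h4
    rw [h1, h2, Finset.mul_sum, Finset.mul_sum, Finset.mul_sum, Finset.sum_mul,
      ← Finset.sum_add_distrib, ← Finset.sum_sub_distrib]
    refine Finset.sum_congr rfl fun j _ => ?_
    rw [hG0, hG0, det_one_add_zero_smul, abs_one]
    ring

/-- As for diffusion, with the pair (i, k) indexing the moving coefficient b_i and the gradient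
component k. Only one gradient is transported, so only Z* appears. -/
theorem hasDerivAt_convection (hΩ : IsOpen Ω)
    (hV : LipschitzWith L V) (hV0 : ∀ x ∉ Ω, V x = 0) {C : ℝ} (hVb : ∀ x, ‖V x‖ ≤ C)
    (hS : IsOpen S) (hSb : Bornology.IsBounded S) (hSΩ : S ⊆ Ω) (hVS : ∀ x ∈ S, V x = Z x + w)
    {b : E d → E d} {Db : Fin d → E d → E d} (hb : IntegrableOn b Ω)
    (hDb : ∀ i, IntegrableOn (Db i) Ω)
    (hbw : ∀ i, HasWeakGradient Ω (fun x => b x i) (Db i)) {Λ : Fin d → ℝ}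
    (hΛ : ∀ i, ∀ᵐ x ∂(volume.restrict Ω), ‖Db i x‖ ≤ Λ i)
    {p q : E d → ℝ} (hp : ContDiff ℝ ∞ p) (hq : ContDiff ℝ ∞ q) :
    IntegrableOn (fun x => (∑ i, ⟪Db i x, V x⟫_ℝ * ∇ p x i) * q x
      + ⟪b x, ∇ p x⟫_ℝ * q x * traceE Z) S ∧
    IntegrableOn (fun x => ⟪b x, star Z (∇ p x)⟫_ℝ * q x) S ∧
    HasDerivAt (fun t => |(1 + t • Z).det| * ∫ x in S,
        ⟪b (flow V t x), Ring.inverse (1 + t • star Z) (∇ p x)⟫_ℝ * q x)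
      ((∫ x in S, ((∑ i, ⟪Db i x, V x⟫_ℝ * ∇ p x i) * q x + ⟪b x, ∇ p x⟫_ℝ * q x * traceE Z))
        - ∫ x in S, ⟪b x, star Z (∇ p x)⟫_ℝ * q x) 0 := by
  have hG : ∀ e : E d, HasDerivAt (fun t : ℝ => Ring.inverse (1 + t • star Z) e) (-(star Z e)) 0 :=
    fun e => by
      simpa using (hasDerivAt_inverse_one_add_smul (star Z)).clm_apply (hasDerivAt_const (0 : ℝ) e)
  have hG0 : ∀ e : E d, Ring.inverse (1 + (0 : ℝ) • star Z) e = e := fun e => by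
    have : 1 + (0 : ℝ) • star Z = 1 := by ext; simp
    rw [this, Ring.inverse_one]; rfl
  let e : Fin d → E d := fun k => EuclideanSpace.single k 1
  have hσ : ∀ j : Fin d × Fin d, HasDerivAt (fun t : ℝ => |(1 + t • Z).det| *
      Ring.inverse (1 + t • star Z) (e j.2) j.1)
      (traceE Z * e j.2 j.1 - star Z (e j.2) j.1) 0 := by
    intro j
    have h1 := (EuclideanSpace.proj (𝕜 := ℝ) j.1).hasFDerivAt.comp_hasDerivAt (0 : ℝ) (hG (e j.2))
    refine ((hasDerivAt_abs_det Z).mul h1).congr_deriv ?_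
    simp only [Function.comp_apply, hG0, det_one_add_zero_smul, abs_one]
    simp
    ring
  have key := hasDerivAt_sum_integral_comp_flow hΩ hV hV0 hVb hS hSb hSΩ hVS
    (a := fun (j : Fin d × Fin d) x => b x j.1) (Da := fun j => Db j.1)
    (fun j => (EuclideanSpace.proj (𝕜 := ℝ) j.1).integrable_comp hb) (fun j => hDb j.1)
    (fun j => hbw j.1) (fun j => hΛ j.1) (g := fun j x => ∇ p x j.2 * q x)
    (fun j => (contDiff_gradient_apply hp j.2).mul hq) hσ
  have hSm := hS.measurableSet
  have hbS := hb.mono_set hSΩ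
  have i1 := integrableOn_mul_of_continuous hSm hSb
    (integrableOn_inner_of_continuous hSm hSb hbS (continuous_gradient hp)) hq.continuous
  have i2 : IntegrableOn (fun x => (∑ i, ⟪Db i x, V x⟫_ℝ * ∇ p x i) * q x) S := by
    refine integrableOn_mul_of_continuous hSm hSb ?_ hq.continuous
    exact integrable_finsetSum _ fun i _ => integrableOn_mul_of_continuous hSm hSb
      (integrableOn_inner_of_continuous hSm hSb ((hDb i).mono_set hSΩ) hV.continuous)
      (contDiff_gradient_apply hp i).continuous
  have i12 : IntegrableOn (fun x => (∑ i, ⟪Db i x, V x⟫_ℝ * ∇ p x i) * q x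
      + ⟪b x, ∇ p x⟫_ℝ * q x * traceE Z) S := i2.add (i1.mul_const _)
  have i3 : IntegrableOn (fun x => ⟪b x, star Z (∇ p x)⟫_ℝ * q x) S :=
    integrableOn_mul_of_continuous hSm hSb (integrableOn_inner_of_continuous hSm hSb hbS
      ((star Z).continuous.comp (continuous_gradient hp))) hq.continuous
  refine ⟨i12, i3, (key.congr_of_eventuallyEq (Eventually.of_forall fun t => ?_)).congr_deriv ?_⟩
  · simp only
    rw [← integral_const_mul]
    congr 1
    funext x
    rw [inner_map_eq_sum, Fintype.sum_prod_type, Finset.sum_mul, Finset.mul_sum]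
    refine Finset.sum_congr rfl fun k _ => ?_
    rw [Finset.sum_mul, Finset.mul_sum]
    refine Finset.sum_congr rfl fun l _ => ?_
    ring
  · rw [← integral_sub i12 i3]
    congr 1
    funext x
    have h1 : ⟪b x, ∇ p x⟫_ℝ = ∑ j : Fin d × Fin d, e j.2 j.1 * (b x j.1 * ∇ p x j.2) := by
      have := inner_map_eq_sum 1 (b x) (∇ p x)
      rw [Fintype.sum_prod_type]
      exact this
    have h2 : ⟪b x, star Z (∇ p x)⟫_ℝ
        = ∑ j : Fin d × Fin d, star Z (e j.2) j.1 * (b x j.1 * ∇ p x j.2) := by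
      rw [Fintype.sum_prod_type]
      exact inner_map_eq_sum (star Z) (b x) (∇ p x)
    have h3 : ∑ i, ⟪Db i x, V x⟫_ℝ * ∇ p x i
        = ∑ j : Fin d × Fin d, e j.2 j.1 * (⟪Db j.1 x, V x⟫_ℝ * ∇ p x j.2) := by
      rw [Fintype.sum_prod_type]
      refine Finset.sum_congr rfl fun i _ => ?_
      simp [e]
    rw [h1, h2, h3, Finset.sum_mul, Finset.sum_mul, Finset.sum_mul, Finset.sum_mul,
      ← Finset.sum_add_distrib, ← Finset.sum_sub_distrib]
    refine Finset.sum_congr rfl fun j _ => ?_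
    rw [hG0, det_one_add_zero_smul, abs_one]
    ring

end Element

theorem contDiff_mvPolynomial_eval (p : MvPolynomial (Fin d) ℝ) :
    ContDiff ℝ ∞ fun x : E d => MvPolynomial.eval x.ofLp p := by
  induction p using MvPolynomial.induction_on with
  | C a => simpa using contDiff_const
  | add p q hp hq => simpa using hp.add hq
  | mul_X p i hp =>
    simpa using hp.mul (EuclideanSpace.proj (𝕜 := ℝ) i).contDiff

theorem gradient_comp_affine {v : E d → ℝ} {F : E d → E d} {B : E d →L[ℝ] E d} {y : E d}
    (hF : HasFDerivAt F B y) (hv : DifferentiableAt ℝ v (F y)) :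
    ∇ (fun z => v (F z)) y = star B (∇ v (F y)) := by
  refine ext_inner_right ℝ fun z => ?_
  rw [ContinuousLinearMap.star_eq_adjoint, ContinuousLinearMap.adjoint_inner_left]
  simp only [gradient, InnerProductSpace.toDual_symm_apply]
  have h : HasFDerivAt (fun z => v (F z)) ((fderiv ℝ v (F y)).comp B) y :=
    hv.hasFDerivAt.comp y hF
  rw [h.fderiv]
  rfl

theorem star_one_add_smul (t : ℝ) (Z : E d →L[ℝ] E d) : star (1 + t • Z) = 1 + t • star Z := by
  refine ContinuousLinearMap.ext fun x => ext_inner_right ℝ fun y => ?_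
  rw [ContinuousLinearMap.star_eq_adjoint, ContinuousLinearMap.star_eq_adjoint,
    ContinuousLinearMap.adjoint_inner_left]
  simp [inner_add_left, inner_add_right, real_inner_smul_left, real_inner_smul_right,
    ContinuousLinearMap.adjoint_inner_left]

theorem measurable_gradient (v : E d → ℝ) : Measurable (∇ v) :=
  (InnerProductSpace.toDual ℝ (E d)).symm.continuous.measurable.comp (measurable_fderiv ℝ v)

/-! ### Piecewise smooth functions and their transport -/

namespace SimplicialMesh

variable {N T : Type*} (M : SimplicialMesh d N T) {Ω : Set (E d)}

/-- Functions that coincide with a smooth function on each element. -/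
def PiecewiseSmooth (v : E d → ℝ) : Prop :=
  ∀ K, ∃ p : E d → ℝ, ContDiff ℝ ∞ p ∧ EqOn v p (M.elem K)

variable {M} {v ψ : E d → ℝ}

theorem piecewiseSmooth_of_mem {r : ℕ} (hv : v ∈ FESpace M Ω r) : M.PiecewiseSmooth v := fun K =>
  have ⟨p, _, hp⟩ := hv.2.2.2 K
  ⟨_, contDiff_mvPolynomial_eval p, hp⟩

theorem PiecewiseSmooth.mul (hv : M.PiecewiseSmooth v) (hψ : M.PiecewiseSmooth ψ) :
    M.PiecewiseSmooth fun x => v x * ψ x := fun K => by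
  obtain ⟨p, hp, hvp⟩ := hv K
  obtain ⟨q, hq, hψq⟩ := hψ K
  exact ⟨_, hp.mul hq, fun x hx => by simp only [hvp hx, hψq hx]⟩

theorem eventuallyEq_of_mem_piece {p : E d → ℝ} {K : T} (h : EqOn v p (M.elem K)) {x : E d}
    (hx : x ∈ M.piece Ω K) : v =ᶠ[𝓝 x] p :=
  (eventually_mem_nhds_iff.2 (mem_interior_iff_mem_nhds.1 hx.1)).mono
    fun _ hy => h (mem_of_mem_nhds hy)

theorem gradient_eq_of_mem_piece {p : E d → ℝ} {K : T} (h : EqOn v p (M.elem K)) {x : E d}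
    (hx : x ∈ M.piece Ω K) : ∇ v x = ∇ p x := by
  simp only [gradient, (eventuallyEq_of_mem_piece h hx).fderiv_eq]

theorem PiecewiseSmooth.differentiableAt (hv : M.PiecewiseSmooth v) {K : T} {x : E d}
    (hx : x ∈ M.piece Ω K) : DifferentiableAt ℝ v x := by
  obtain ⟨p, hp, hvp⟩ := hv K
  exact ((hp.differentiable (by simp)) x).congr_of_eventuallyEq (eventuallyEq_of_mem_piece hvp hx)

theorem PiecewiseSmooth.exists_lipschitzOnWith [Finite T] (hv : M.PiecewiseSmooth v) :
    ∃ C : ℝ≥0, ∀ K, LipschitzOnWith C v (M.elem K) := by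
  have := Fintype.ofFinite T
  have h : ∀ K, ∃ C : ℝ≥0, LipschitzOnWith C v (M.elem K) := fun K => by
    obtain ⟨p, hp, hvp⟩ := hv K
    obtain ⟨C, hC⟩ := (M.isCompact_elem K).exists_bound_of_continuousOn
      (hp.continuous_fderiv (by simp)).continuousOn
    refine ⟨C.toNNReal, fun x hx y hy => ?_⟩
    rw [hvp hx, hvp hy]
    refine (M.convex_elem K).lipschitzOnWith_of_nnnorm_fderiv_le (𝕜 := ℝ)
      (fun x _ => (hp.differentiable (by simp)) x) (fun x hx => ?_) hx hy
    rw [← NNReal.coe_le_coe]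
    exact (hC x hx).trans (Real.le_coe_toNNReal C)
  choose C hC using h
  exact ⟨∑ K, C K, fun K => (hC K).weaken
    (Finset.single_le_sum (f := C) (fun _ _ => zero_le) (Finset.mem_univ K))⟩

/-- The smooth representatives agree with v on closed elements, common faces included, so continuity
follows by pasting over a finite closed cover. -/
theorem PiecewiseSmooth.continuousOn [Finite T] (hM : M.IsMeshOf Ω) (hv : M.PiecewiseSmooth v) :
    ContinuousOn v Ω := by
  obtain ⟨C, hC⟩ := hv.exists_lipschitzOnWith
  have h := (locallyFinite_of_finite M.elem).continuousOn_iUnion M.isClosed_elem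
    fun K => (hC K).continuousOn
  rw [hM.cover] at h
  exact h.mono subset_closure

theorem PiecewiseSmooth.exists_bound [Finite T] (hM : M.IsMeshOf Ω) (hv : M.PiecewiseSmooth v) :
    ∃ C : ℝ, ∀ x ∈ Ω, ‖v x‖ ≤ C := by
  obtain ⟨C, hC⟩ := hv.exists_lipschitzOnWith
  have h := (locallyFinite_of_finite M.elem).continuousOn_iUnion M.isClosed_elem
    fun K => (hC K).continuousOn
  rw [hM.cover] at h
  obtain ⟨C, hC⟩ := (M.isBounded_of_isMeshOf hM).isCompact_closure.exists_bound_of_continuousOn h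
  exact ⟨C, fun x hx => hC x (subset_closure hx)⟩

theorem PiecewiseSmooth.exists_gradient_bound (hv : M.PiecewiseSmooth v) (Ω : Set (E d)) (K : T) :
    ∃ C : ℝ, ∀ x ∈ M.piece Ω K, ‖∇ v x‖ ≤ C := by
  obtain ⟨p, hp, hvp⟩ := hv K
  obtain ⟨C, hC⟩ := (M.isCompact_elem K).exists_bound_of_continuousOn
    (continuous_gradient hp).continuousOn
  refine ⟨C, fun x hx => ?_⟩
  rw [gradient_eq_of_mem_piece hvp hx]
  exact hC x (M.piece_subset_elem K hx)

theorem PiecewiseSmooth.integrableOn_mul [Finite T] (hM : M.IsMeshOf Ω) (hv : M.PiecewiseSmooth v)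
    {f : E d → ℝ} (hf : IntegrableOn f Ω) : IntegrableOn (fun x => f x * v x) Ω := by
  obtain ⟨C, hC⟩ := hv.exists_bound hM
  exact hf.mul_bdd ((hv.continuousOn hM).aestronglyMeasurable hM.isOpen.measurableSet)
    ((ae_restrict_mem hM.isOpen.measurableSet).mono hC)

theorem integrableOn_of_piece [Finite T] (hM : M.IsMeshOf Ω) {F : Type*} [NormedAddCommGroup F]
    {f : E d → F} (hf : ∀ K, IntegrableOn f (M.piece Ω K)) : IntegrableOn f Ω := by
  have h : ∀ᵐ x ∂(volume.restrict Ω), x ∈ ⋃ K, M.piece Ω K :=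
    M.ae_restrict_of_piece hM fun K x hx => mem_iUnion.2 ⟨K, hx⟩
  have h1 : volume.restrict Ω = volume.restrict (⋃ K, M.piece Ω K) := by
    have h2 : ⋃ K, M.piece Ω K ⊆ Ω := iUnion_subset fun K => inter_subset_right
    rw [← Measure.restrict_eq_self_of_ae_mem h, Measure.restrict_restrict_of_subset h2]
  rw [IntegrableOn, h1]
  exact integrableOn_finite_iUnion.2 hf

variable (X : E d → E d)

/-- The path from x to its moved position stays in Ω, so the Lipschitz bounds on the elements
combine along it. This supplies the domination needed for load terms. -/
theorem PiecewiseSmooth.exists_abs_flow_sub_le [Fintype N] [Finite T]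
    (hM : M.IsMeshOf Ω)
    (hv : M.PiecewiseSmooth v) {L : ℝ≥0} (hL : LipschitzWith L (M.velInterp Ω X)) :
    ∃ C : ℝ, ∀ t : ℝ, |t| * L < 1 → ∀ x ∈ Ω,
      |v (flow (M.velInterp Ω X) t x) - v x| ≤ C * |t| := by
  obtain ⟨C, hC⟩ := hv.exists_lipschitzOnWith
  obtain ⟨B, hB⟩ := M.exists_norm_velInterp_le X hM
  refine ⟨C * B, fun t ht x hx => ?_⟩
  have h := dist_le_of_finite_cover M.isClosed_elem hC (x := x) (y := flow (M.velInterp Ω X) t x) ?_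
  · rw [dist_comm, Real.dist_eq, dist_comm, dist_eq_norm] at h
    refine h.trans ?_
    simp only [flow, add_sub_cancel_left, norm_smul, Real.norm_eq_abs]
    rw [mul_assoc, mul_comm |t|]
    gcongr
    exact hB x
  · rw [hM.cover]
    exact (segment_flow_subset hL (M.velInterp_eq_zero X hM) ht hx).trans subset_closure

/-- The derivative of a load term: `f` need not be differentiable. -/
theorem hasDerivAt_sum_integral_load [Fintype N] [Fintype T] (hM : M.IsMeshOf Ω)
    (hv : M.PiecewiseSmooth v)
    {f : E d → ℝ} (hf : IntegrableOn f Ω) :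
    HasDerivAt (fun t => ∑ K, ∫ y in flow (M.velInterp Ω X) t '' M.piece Ω K,
        f y * M.push Ω X t K v y)
      (-∫ x in Ω, f x * ⟪∇ v x, M.velInterp Ω X x⟫_ℝ) 0 := by
  obtain ⟨L, hL⟩ := M.exists_lipschitzWith_velInterp X hM
  obtain ⟨C, hC⟩ := hv.exists_abs_flow_sub_le X hM hL
  have hV0 := M.velInterp_eq_zero X hM
  have h := hasDerivAt_integral_comp_flowInv hM.isOpen.measurableSet hL hV0 hf
    (hv.continuousOn hM) (hv.integrableOn_mul hM hf) hC
    (M.ae_restrict_of_piece hM fun K x hx => hv.differentiableAt hx)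
  refine h.congr_of_eventuallyEq ?_
  have hdet : ∀ᶠ t : ℝ in 𝓝 0, ∀ K, (1 + t • M.velGrad Ω X K).det ≠ 0 :=
    eventually_all.2 fun K => eventually_det_ne_zero _
  have hhalf : ∀ᶠ t : ℝ in 𝓝 0, |t| * L < 1 / 2 :=
    (by fun_prop : Continuous fun t : ℝ => |t| * (L : ℝ)).continuousAt.eventually_lt_const
      (by norm_num)
  filter_upwards [hdet, hhalf] with t hdet ht'
  have ht : |t| * L < 1 := by linarith
  have hint : IntegrableOn (fun y => f y * v (flowInv (M.velInterp Ω X) t y)) Ω := by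
    obtain ⟨B, hB⟩ := hv.exists_bound hM
    refine hf.mul_bdd (c := B) (ContinuousOn.aestronglyMeasurable ((hv.continuousOn hM).comp
      (flowInv_lipschitz hL ht'.le).continuous.continuousOn
      fun y hy => flowInv_mem hL hV0 ht hy) hM.isOpen.measurableSet) ?_
    filter_upwards [ae_restrict_mem hM.isOpen.measurableSet] with y hy
    exact hB _ (flowInv_mem hL hV0 ht hy)
  -- On the moved pieces the transported function is v ∘ flowInv, so the elementwise integrals
  -- recombine into one over the fixed domain Ω.
  rw [← M.sum_integral_flow_image X hM hL ht hint]
  refine Finset.sum_congr rfl fun K _ => ?_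
  refine setIntegral_congr_fun (isOpen_flow_image hL ht (M.isOpen_piece hM.isOpen K)).measurableSet
    ?_
  rintro _ ⟨x, hx, rfl⟩
  simp only [push, flowInv_flow hL ht, M.elementMap_flow X (hdet K) (M.piece_subset_elem K hx)]

theorem toEuclideanCLM_eq_inverse {t : ℝ} {K : T} (hdet : (1 + t • M.velGrad Ω X K).det ≠ 0) :
    Matrix.toEuclideanCLM (𝕜 := ℝ) (edgeMatrix (M.vert K) * (edgeMatrix (M.vertAt Ω X t K))⁻¹)
      = Ring.inverse (1 + t • M.velGrad Ω X K) := by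
  have hE : IsUnit (M.edge K).det := isUnit_iff_ne_zero.2 (M.det_vert K)
  have hEt : IsUnit (edgeMatrix (M.vertAt Ω X t K)).det := by
    rw [isUnit_iff_ne_zero, det_edgeMatrix_vertAt]
    exact mul_ne_zero hdet (M.det_vert K)
  have h2 : 1 + t • M.velGrad Ω X K = Matrix.toEuclideanCLM (𝕜 := ℝ)
      (edgeMatrix (M.vertAt Ω X t K) * (M.edge K)⁻¹) := by
    rw [edgeMatrix_vertAt, add_mul, Matrix.mul_nonsing_inv _ hE]
    simp [velGrad]
  set A := edgeMatrix (M.vertAt Ω X t K)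
  have h3 : (M.edge K * A⁻¹) * (A * (M.edge K)⁻¹) = 1 := by
    rw [Matrix.mul_assoc, Matrix.nonsing_inv_mul_cancel_left _ _ hEt, Matrix.mul_nonsing_inv _ hE]
  have h4 : (A * (M.edge K)⁻¹) * (M.edge K * A⁻¹) = 1 := by
    rw [Matrix.mul_assoc, Matrix.nonsing_inv_mul_cancel_left _ _ hE, Matrix.mul_nonsing_inv _ hEt]
  let u : (E d →L[ℝ] E d)ˣ :=
    ⟨Matrix.toEuclideanCLM (𝕜 := ℝ) (A * (M.edge K)⁻¹),
      Matrix.toEuclideanCLM (𝕜 := ℝ) (M.edge K * A⁻¹),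
      by rw [← map_mul, h4, map_one], by rw [← map_mul, h3, map_one]⟩
  rw [h2]
  exact (Ring.inverse_unit u).symm

/-- Chain rule for the inverse element map, whose linear part is (1 + tZ)⁻¹; gradients transform by
the adjoint (1 + tZ*)⁻¹. -/
theorem gradient_push [Fintype N] {t : ℝ} {K : T} (hdet : (1 + t • M.velGrad Ω X K).det ≠ 0)
    (hv : M.PiecewiseSmooth v) {x : E d} (hx : x ∈ M.piece Ω K) :
    ∇ (M.push Ω X t K v) (flow (M.velInterp Ω X) t x)
      = Ring.inverse (1 + t • star (M.velGrad Ω X K)) (∇ v x) := by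
  have hel := M.elementMap_flow X hdet (M.piece_subset_elem K hx)
  have hF : HasFDerivAt (elementMap (M.vertAt Ω X t K) (M.vert K))
      (Ring.inverse (1 + t • M.velGrad Ω X K)) (flow (M.velInterp Ω X) t x) := by
    rw [← toEuclideanCLM_eq_inverse X hdet]
    have h := ((Matrix.toEuclideanCLM (𝕜 := ℝ)
      (edgeMatrix (M.vert K) * (edgeMatrix (M.vertAt Ω X t K))⁻¹)).hasFDerivAt.comp
      (flow (M.velInterp Ω X) t x) ((hasFDerivAt_id _).sub_const (M.vertAt Ω X t K 0))).const_add
      (M.vert K 0)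
    exact h
  have h := gradient_comp_affine hF (v := v) (by rw [hel]; exact hv.differentiableAt hx)
  rw [hel] at h
  have hs : Ring.inverse (star (1 + t • M.velGrad Ω X K))
      = star (Ring.inverse (1 + t • M.velGrad Ω X K)) := Ring.inverse_star _
  rw [← star_one_add_smul, hs]
  exact h

theorem push_flow [Fintype N] {t : ℝ} {K : T} (hdet : (1 + t • M.velGrad Ω X K).det ≠ 0)
    {x : E d} (hx : x ∈ M.piece Ω K) :
    M.push Ω X t K v (flow (M.velInterp Ω X) t x) = v x := by
  rw [push, M.elementMap_flow X hdet (M.piece_subset_elem K hx)]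

end SimplicialMesh

/-! ### Integrability and bounds for the Sobolev coefficients -/

section Sobolev

variable {Ω : Set (E d)} {u : E d → ℝ} {g : E d → E d} {p : ℝ≥0∞}

theorem IsSobolevWith.integrableOn (h : IsSobolevWith Ω p u g) (hp : 1 ≤ p)
    (hΩ : Bornology.IsBounded Ω) : IntegrableOn u Ω :=
  have : IsFiniteMeasure (volume.restrict Ω) := ⟨by simpa using hΩ.measure_lt_top⟩
  h.memLp.integrable hp

theorem IsSobolevWith.integrableOn_grad (h : IsSobolevWith Ω p u g) (hp : 1 ≤ p)
    (hΩ : Bornology.IsBounded Ω) : IntegrableOn g Ω :=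
  have : IsFiniteMeasure (volume.restrict Ω) := ⟨by simpa using hΩ.measure_lt_top⟩
  h.memLp_grad.integrable hp

theorem IsSobolevWith.exists_norm_grad_le (h : IsSobolevWith Ω ⊤ u g) :
    ∃ Λ : ℝ, ∀ᵐ x ∂(volume.restrict Ω), ‖g x‖ ≤ Λ := by
  have h1 := h.memLp_grad.2
  rw [eLpNorm_exponent_top] at h1
  refine ⟨(eLpNormEssSup g (volume.restrict Ω)).toReal, ?_⟩
  filter_upwards [enorm_ae_le_eLpNormEssSup g (volume.restrict Ω)] with x hx
  rw [← toReal_enorm]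
  exact ENNReal.toReal_mono h1.ne hx

theorem integrableOn_of_apply {b : E d → E d} (hb : ∀ i, IntegrableOn (fun x => b x i) Ω) :
    IntegrableOn b Ω := by
  have h : b = fun x => ∑ i, b x i • EuclideanSpace.single i (1 : ℝ) :=
    funext fun x => (sum_smul_single (b x)).symm
  rw [h]
  exact integrable_finsetSum _ fun i _ => (hb i).smul_const _

end Sobolev

/-! ### The bilinear form on deformed elements -/

namespace SimplicialMesh

variable {N T : Type*} {M : SimplicialMesh d N T} {Ω : Set (E d)} {v ψ : E d → ℝ} (X : E d → E d)

theorem mulE_star_velGrad (K : T) (x : E d) :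
    mulE (((M.edge K)⁻¹)ᵀ * (M.edgeVel Ω X K)ᵀ) x = star (M.velGrad Ω X K) x := by
  have h : star (M.velGrad Ω X K)
      = Matrix.toEuclideanCLM (𝕜 := ℝ) (((M.edge K)⁻¹)ᵀ * (M.edgeVel Ω X K)ᵀ) := by
    rw [velGrad, ← map_star, Matrix.star_eq_conjTranspose,
      Matrix.conjTranspose_eq_transpose_of_trivial, Matrix.transpose_mul]
  rw [h, mulE_eq]

theorem mulE_velGrad_add_star (K : T) (x : E d) :
    mulE (M.edgeVel Ω X K * (M.edge K)⁻¹ + ((M.edge K)⁻¹)ᵀ * (M.edgeVel Ω X K)ᵀ) x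
      = (M.velGrad Ω X K + star (M.velGrad Ω X K)) x := by
  rw [add_apply, ← mulE_star_velGrad, mulE_eq, map_add, add_apply]
  rfl

theorem divergence_velInterp [Fintype N] {K : T} {x : E d} (hx : x ∈ M.piece Ω K) :
    divergence (M.velInterp Ω X) x = traceE (M.velGrad Ω X K) := by
  have h : HasFDerivAt (M.velInterp Ω X) (M.velGrad Ω X K) x := by
    refine ((M.velGrad Ω X K).hasFDerivAt.add_const (M.velConst Ω X K)).congr_of_eventuallyEq ?_
    filter_upwards [mem_interior_iff_mem_nhds.1 hx.1] with y hy
    exact M.velInterp_eq_affine X hy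
  rw [divergence, h.fderiv, traceE]

theorem elem_ae_eq_piece [Finite T] (hM : M.IsMeshOf Ω) (K : T) :
    M.elem K =ᵐ[volume] M.piece Ω K :=
  ae_eq_set.2 ⟨M.volume_elem_diff_piece hM K,
    by rw [sdiff_eq_empty.2 (M.piece_subset_elem K), measure_empty]⟩

theorem PiecewiseSmooth.sum {κ : Type*} [Fintype κ] {B : κ → E d → ℝ}
    (hB : ∀ i, M.PiecewiseSmooth (B i)) (y : κ → ℝ) :
    M.PiecewiseSmooth fun x => ∑ i, y i * B i x := fun K => by
  choose p hp hBp using fun i => hB i K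
  exact ⟨fun x => ∑ i, y i * p i x, ContDiff.sum fun i _ => contDiff_const.mul (hp i),
    fun x hx => Finset.sum_congr rfl fun i _ => by rw [hBp i hx]⟩

theorem gradient_sum {κ : Type*} [Fintype κ] {B : κ → E d → ℝ} {x : E d}
    (hB : ∀ i, DifferentiableAt ℝ (B i) x) (y : κ → ℝ) :
    ∇ (fun x => ∑ i, y i * B i x) x = ∑ i, y i • ∇ (B i) x := by
  have h : HasFDerivAt (fun x => ∑ i, y i * B i x) (∑ i, y i • fderiv ℝ (B i) x) x :=
    HasFDerivAt.fun_sum fun i _ => (hB i).hasFDerivAt.const_mul (y i)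
  simp only [gradient, h.fderiv, map_sum, map_smul]

theorem inner_gradient_mul {x z : E d} (hv : DifferentiableAt ℝ v x)
    (hψ : DifferentiableAt ℝ ψ x) :
    ⟪∇ (fun x => v x * ψ x) x, z⟫_ℝ = v x * ⟪∇ ψ x, z⟫_ℝ + ψ x * ⟪∇ v x, z⟫_ℝ := by
  have h : HasFDerivAt (fun x => v x * ψ x) (v x • fderiv ℝ ψ x + ψ x • fderiv ℝ v x) x :=
    hv.hasFDerivAt.mul hψ.hasFDerivAt
  simp [gradient, h.fderiv, inner_add_left, real_inner_smul_left]

/-- The image of a piece under the deformation. -/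
def pieceAt [Fintype N] (M : SimplicialMesh d N T) (Ω : Set (E d)) (X : E d → E d) (t : ℝ) (K : T) :
    Set (E d) :=
  flow (M.velInterp Ω X) t '' M.piece Ω K

section Deformed

variable [Fintype N] {t : ℝ} {K : T} {L : ℝ≥0} {a c : E d → ℝ} {b : E d → E d}

theorem measurableSet_pieceAt (hM : M.IsMeshOf Ω) (hL : LipschitzWith L (M.velInterp Ω X))
    (ht : |t| * L < 1) : MeasurableSet (M.pieceAt Ω X t K) :=
  (isOpen_flow_image hL ht (M.isOpen_piece hM.isOpen K)).measurableSet

theorem pieceAt_subset (hM : M.IsMeshOf Ω) (hL : LipschitzWith L (M.velInterp Ω X))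
    (ht : |t| * L < 1) : M.pieceAt Ω X t K ⊆ Ω :=
  image_subset_iff.2 fun _ hx => flow_mem hL (M.velInterp_eq_zero X hM) ht hx.2

theorem PiecewiseSmooth.aestronglyMeasurable_push (hM : M.IsMeshOf Ω)
    (hL : LipschitzWith L (M.velInterp Ω X)) (ht : |t| * L < 1)
    (hdet : (1 + t • M.velGrad Ω X K).det ≠ 0) (hv : M.PiecewiseSmooth v) :
    AEStronglyMeasurable (M.push Ω X t K v) (volume.restrict (M.pieceAt Ω X t K)) := by
  obtain ⟨p, hp, hvp⟩ := hv K
  have hc : Continuous fun y => p (elementMap (M.vertAt Ω X t K) (M.vert K) y) := by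
    refine hp.continuous.comp (continuous_const.add ?_)
    exact (Matrix.toEuclideanCLM (𝕜 := ℝ) _).continuous.comp (continuous_id.sub continuous_const)
  refine hc.aestronglyMeasurable.congr ?_
  filter_upwards [ae_restrict_mem (measurableSet_pieceAt X hM hL ht)] with y hy
  obtain ⟨x, hx, rfl⟩ := hy
  rw [push, M.elementMap_flow X hdet (M.piece_subset_elem K hx), hvp (M.piece_subset_elem K hx)]

theorem PiecewiseSmooth.exists_push_bound [Finite T] (hM : M.IsMeshOf Ω)
    (hdet : (1 + t • M.velGrad Ω X K).det ≠ 0) (hv : M.PiecewiseSmooth v) :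
    ∃ C : ℝ, ∀ y ∈ M.pieceAt Ω X t K, ‖M.push Ω X t K v y‖ ≤ C := by
  obtain ⟨C, hC⟩ := hv.exists_bound hM
  refine ⟨C, ?_⟩
  rintro _ ⟨x, hx, rfl⟩
  rw [push_flow X hdet hx]
  exact hC x hx.2

theorem PiecewiseSmooth.exists_gradient_push_bound
    (hdet : (1 + t • M.velGrad Ω X K).det ≠ 0) (hv : M.PiecewiseSmooth v) :
    ∃ C : ℝ, ∀ y ∈ M.pieceAt Ω X t K, ‖∇ (M.push Ω X t K v) y‖ ≤ C := by
  obtain ⟨C, hC⟩ := hv.exists_gradient_bound Ω K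
  refine ⟨‖Ring.inverse (1 + t • star (M.velGrad Ω X K))‖ * C, ?_⟩
  rintro _ ⟨x, hx, rfl⟩
  rw [gradient_push X hdet hv hx]
  exact (ContinuousLinearMap.le_opNorm _ _).trans (by gcongr; exact hC x hx)

variable (hM : M.IsMeshOf Ω) (hL : LipschitzWith L (M.velInterp Ω X))
  (ht : |t| * L < 1) (hdet : (1 + t • M.velGrad Ω X K).det ≠ 0)
  (hv : M.PiecewiseSmooth v) (hψ : M.PiecewiseSmooth ψ)

include hM hL ht hdet hv hψ

theorem integrableOn_diffusion_push (ha : IntegrableOn a Ω) :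
    IntegrableOn (fun y => a y * ⟪∇ (M.push Ω X t K v) y, ∇ (M.push Ω X t K ψ) y⟫_ℝ)
      (M.pieceAt Ω X t K) := by
  obtain ⟨C, hC⟩ := hv.exists_gradient_push_bound X hdet
  obtain ⟨C', hC'⟩ := hψ.exists_gradient_push_bound X hdet
  refine (ha.mono_set (pieceAt_subset X hM hL ht)).mul_bdd (c := C * C')
    ((measurable_gradient _).inner (measurable_gradient _)).aestronglyMeasurable ?_
  filter_upwards [ae_restrict_mem (measurableSet_pieceAt X hM hL ht)] with y hy
  exact (norm_inner_le_norm _ _).trans (mul_le_mul (hC y hy) (hC' y hy) (norm_nonneg _)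
    ((norm_nonneg _).trans (hC y hy)))

theorem integrableOn_convection_push [Finite T] (hb : IntegrableOn b Ω) :
    IntegrableOn (fun y => ⟪b y, ∇ (M.push Ω X t K v) y⟫_ℝ * M.push Ω X t K ψ y)
      (M.pieceAt Ω X t K) := by
  obtain ⟨C, hC⟩ := hv.exists_gradient_push_bound X hdet
  obtain ⟨C', hC'⟩ := hψ.exists_push_bound X hM hdet
  have hmem := ae_restrict_mem (μ := volume) (measurableSet_pieceAt (K := K) X hM hL ht)
  have hb' := hb.mono_set (pieceAt_subset (K := K) X hM hL ht)
  have h1 : IntegrableOn (fun y => ⟪b y, ∇ (M.push Ω X t K v) y⟫_ℝ) (M.pieceAt Ω X t K) := by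
    refine (hb'.norm.mul_const C).mono'
      (hb'.aestronglyMeasurable.inner (measurable_gradient _).aestronglyMeasurable) ?_
    filter_upwards [hmem] with y hy
    refine (norm_inner_le_norm _ _).trans ?_
    gcongr
    exact hC y hy
  exact h1.mul_bdd (hψ.aestronglyMeasurable_push X hM hL ht hdet) (hmem.mono hC')

theorem integrableOn_reaction_push [Finite T] (hc : IntegrableOn c Ω) :
    IntegrableOn (fun y => c y * M.push Ω X t K v y * M.push Ω X t K ψ y)
      (M.pieceAt Ω X t K) := by
  obtain ⟨C, hC⟩ := hv.exists_push_bound X hM hdet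
  obtain ⟨C', hC'⟩ := hψ.exists_push_bound X hM hdet
  have hmem := ae_restrict_mem (μ := volume) (measurableSet_pieceAt (K := K) X hM hL ht)
  exact ((hc.mono_set (pieceAt_subset X hM hL ht)).mul_bdd
    (hv.aestronglyMeasurable_push X hM hL ht hdet) (hmem.mono hC)).mul_bdd
    (hψ.aestronglyMeasurable_push X hM hL ht hdet) (hmem.mono hC')

theorem integrableOn_bilin_push [Finite T] (ha : IntegrableOn a Ω) (hb : IntegrableOn b Ω)
    (hc : IntegrableOn c Ω) :
    IntegrableOn (fun y => a y * ⟪∇ (M.push Ω X t K v) y, ∇ (M.push Ω X t K ψ) y⟫_ℝ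
      + ⟪b y, ∇ (M.push Ω X t K v) y⟫_ℝ * M.push Ω X t K ψ y
      + c y * M.push Ω X t K v y * M.push Ω X t K ψ y) (M.pieceAt Ω X t K) :=
  ((integrableOn_diffusion_push X hM hL ht hdet hv hψ ha).add
    (integrableOn_convection_push X hM hL ht hdet hv hψ hb)).add
    (integrableOn_reaction_push X hM hL ht hdet hv hψ hc)

/-- The reaction term is bracketed as c · (vψ) so that it has the shape of a load with density c. -/
theorem bilin_elemAt_eq [Finite T] (ha : IntegrableOn a Ω) (hb : IntegrableOn b Ω)
    (hc : IntegrableOn c Ω) :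
    bilin (M.elemAt Ω X t K) a b c (M.push Ω X t K v) (M.push Ω X t K ψ)
      = (∫ y in M.pieceAt Ω X t K,
          a y * ⟪∇ (M.push Ω X t K v) y, ∇ (M.push Ω X t K ψ) y⟫_ℝ)
        + (∫ y in M.pieceAt Ω X t K, ⟪b y, ∇ (M.push Ω X t K v) y⟫_ℝ * M.push Ω X t K ψ y)
        + ∫ y in M.pieceAt Ω X t K, c y * (M.push Ω X t K v y * M.push Ω X t K ψ y) := by
  have i1 := integrableOn_diffusion_push X hM hL ht hdet hv hψ ha
  have i2 := integrableOn_convection_push X hM hL ht hdet hv hψ hb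
  have i3 := integrableOn_reaction_push X hM hL ht hdet hv hψ hc
  rw [bilin, setIntegral_congr_set (M.elemAt_ae_eq X hM K)]
  refine (integral_add (i1.add i2) i3).trans ?_
  refine congrArg₂ _ (integral_add i1 i2) ?_
  simp only [mul_assoc]

omit hv in
/-- The form on the deformed mesh is linear in its first argument. -/
theorem bilin_elemAt_sum [Finite T] {κ : Type*} [Fintype κ] {B : κ → E d → ℝ}
    (hB : ∀ i, M.PiecewiseSmooth (B i)) (y : κ → ℝ) (ha : IntegrableOn a Ω)
    (hb : IntegrableOn b Ω) (hc : IntegrableOn c Ω) :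
    bilin (M.elemAt Ω X t K) a b c (M.push Ω X t K fun x => ∑ i, y i * B i x) (M.push Ω X t K ψ)
      = ∑ i, y i * bilin (M.elemAt Ω X t K) a b c (M.push Ω X t K (B i)) (M.push Ω X t K ψ) := by
  simp only [bilin, setIntegral_congr_set (M.elemAt_ae_eq X hM K)]
  simp only [← integral_const_mul]
  rw [← integral_finsetSum]
  · refine setIntegral_congr_fun (measurableSet_pieceAt X hM hL ht) ?_
    rintro _ ⟨x, hx, rfl⟩
    simp only [gradient_push X hdet (PiecewiseSmooth.sum hB y) hx, gradient_push X hdet (hB _) hx,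
      gradient_push X hdet hψ hx, push_flow X hdet hx,
      gradient_sum (fun i => (hB i).differentiableAt hx) y, map_sum, map_smul, sum_inner, inner_sum,
      real_inner_smul_left, real_inner_smul_right, Finset.mul_sum, Finset.sum_mul,
      ← Finset.sum_add_distrib]
    refine Finset.sum_congr rfl fun i _ => ?_
    ring
  · exact fun i _ => (integrableOn_bilin_push X hM hL ht hdet (hB i) hψ ha hb hc).const_mul _

end Deformed

/-! ### Time derivatives of the form on the deformed mesh -/

section Derivative

variable [Fintype N] [Fintype T] {a c : E d → ℝ} {b Da : E d → E d}
  {Db : Fin d → E d → E d}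

theorem hasDerivAt_diffusion_push (hM : M.IsMeshOf Ω) (ha : IsSobolevWith Ω ⊤ a Da)
    (hv : M.PiecewiseSmooth v) (hψ : M.PiecewiseSmooth ψ) (K : T) :
    IntegrableOn (fun x => ⟪Da x, M.velInterp Ω X x⟫_ℝ * ⟪∇ v x, ∇ ψ x⟫_ℝ
      + a x * ⟪∇ v x, ∇ ψ x⟫_ℝ * divergence (M.velInterp Ω X) x) (M.piece Ω K) ∧
    IntegrableOn (fun x => a x * ⟪∇ v x,
      mulE (M.edgeVel Ω X K * (M.edge K)⁻¹ + ((M.edge K)⁻¹)ᵀ * (M.edgeVel Ω X K)ᵀ) (∇ ψ x)⟫_ℝ)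
      (M.piece Ω K) ∧
    HasDerivAt (fun t => ∫ y in M.pieceAt Ω X t K,
        a y * ⟪∇ (M.push Ω X t K v) y, ∇ (M.push Ω X t K ψ) y⟫_ℝ)
      ((∫ x in M.piece Ω K, (⟪Da x, M.velInterp Ω X x⟫_ℝ * ⟪∇ v x, ∇ ψ x⟫_ℝ
          + a x * ⟪∇ v x, ∇ ψ x⟫_ℝ * divergence (M.velInterp Ω X) x))
        - ∫ x in M.piece Ω K, a x * ⟪∇ v x, mulE (M.edgeVel Ω X K * (M.edge K)⁻¹
          + ((M.edge K)⁻¹)ᵀ * (M.edgeVel Ω X K)ᵀ) (∇ ψ x)⟫_ℝ) 0 := by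
  obtain ⟨L, hL⟩ := M.exists_lipschitzWith_velInterp X hM
  obtain ⟨C, hC⟩ := M.exists_norm_velInterp_le X hM
  obtain ⟨Λ, hΛ⟩ := ha.exists_norm_grad_le
  obtain ⟨p, hp, hvp⟩ := hv K
  obtain ⟨q, hq, hψq⟩ := hψ K
  have hΩb := M.isBounded_of_isMeshOf hM
  have hS := M.isOpen_piece hM.isOpen K
  have hSΩ : M.piece Ω K ⊆ Ω := inter_subset_right
  have hVS : ∀ x ∈ M.piece Ω K, M.velInterp Ω X x = M.velGrad Ω X K x + M.velConst Ω X K :=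
    fun x hx => M.velInterp_eq_affine X (M.piece_subset_elem K hx)
  obtain ⟨h1, h2, h3⟩ := hasDerivAt_diffusion hM.isOpen hL (M.velInterp_eq_zero X hM) hC hS
    (hΩb.subset hSΩ) hSΩ hVS (ha.integrableOn le_top hΩb) (ha.integrableOn_grad le_top hΩb)
    ha.weak hΛ hp hq
  have e1 : EqOn (fun x => ⟪Da x, M.velInterp Ω X x⟫_ℝ * ⟪∇ p x, ∇ q x⟫_ℝ
      + a x * ⟪∇ p x, ∇ q x⟫_ℝ * traceE (M.velGrad Ω X K))
      (fun x => ⟪Da x, M.velInterp Ω X x⟫_ℝ * ⟪∇ v x, ∇ ψ x⟫_ℝ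
      + a x * ⟪∇ v x, ∇ ψ x⟫_ℝ * divergence (M.velInterp Ω X) x) (M.piece Ω K) := fun x hx => by
    simp only [gradient_eq_of_mem_piece hvp hx, gradient_eq_of_mem_piece hψq hx,
      divergence_velInterp X hx]
  have e2 : EqOn (fun x => a x * ⟪∇ p x, (M.velGrad Ω X K + star (M.velGrad Ω X K)) (∇ q x)⟫_ℝ)
      (fun x => a x * ⟪∇ v x, mulE (M.edgeVel Ω X K * (M.edge K)⁻¹
          + ((M.edge K)⁻¹)ᵀ * (M.edgeVel Ω X K)ᵀ) (∇ ψ x)⟫_ℝ) (M.piece Ω K) := fun x hx => by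
    simp only [gradient_eq_of_mem_piece hvp hx, gradient_eq_of_mem_piece hψq hx,
      mulE_velGrad_add_star]
  refine ⟨h1.congr_fun e1 hS.measurableSet, h2.congr_fun e2 hS.measurableSet, ?_⟩
  rw [← setIntegral_congr_fun hS.measurableSet e1, ← setIntegral_congr_fun hS.measurableSet e2]
  refine h3.congr_of_eventuallyEq ?_
  filter_upwards [eventually_det_ne_zero (M.velGrad Ω X K), eventually_abs_mul_lt_one L]
    with t hdet ht
  -- Pulling back to the fixed piece turns the transported gradients into (1 + tZ*)⁻¹ applied to
  -- gradients of smooth functions.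
  rw [pieceAt, integral_flow_image hL ht hS.measurableSet hVS]
  congr 1
  refine setIntegral_congr_fun hS.measurableSet fun x hx => ?_
  simp only [gradient_push X hdet hv hx, gradient_push X hdet hψ hx,
    gradient_eq_of_mem_piece hvp hx, gradient_eq_of_mem_piece hψq hx]

theorem hasDerivAt_convection_push (hM : M.IsMeshOf Ω)
    (hb : ∀ i, IsSobolevWith Ω ⊤ (fun x => b x i) (Db i))
    (hv : M.PiecewiseSmooth v) (hψ : M.PiecewiseSmooth ψ) (K : T) :
    IntegrableOn (fun x => (∑ i, ⟪Db i x, M.velInterp Ω X x⟫_ℝ * ∇ v x i) * ψ x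
      + ⟪b x, ∇ v x⟫_ℝ * ψ x * divergence (M.velInterp Ω X) x) (M.piece Ω K) ∧
    IntegrableOn (fun x => ⟪b x, mulE (((M.edge K)⁻¹)ᵀ * (M.edgeVel Ω X K)ᵀ) (∇ v x)⟫_ℝ * ψ x)
      (M.piece Ω K) ∧
    HasDerivAt (fun t => ∫ y in M.pieceAt Ω X t K,
        ⟪b y, ∇ (M.push Ω X t K v) y⟫_ℝ * M.push Ω X t K ψ y)
      ((∫ x in M.piece Ω K, ((∑ i, ⟪Db i x, M.velInterp Ω X x⟫_ℝ * ∇ v x i) * ψ x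
          + ⟪b x, ∇ v x⟫_ℝ * ψ x * divergence (M.velInterp Ω X) x))
        - ∫ x in M.piece Ω K,
          ⟪b x, mulE (((M.edge K)⁻¹)ᵀ * (M.edgeVel Ω X K)ᵀ) (∇ v x)⟫_ℝ * ψ x) 0 := by
  obtain ⟨L, hL⟩ := M.exists_lipschitzWith_velInterp X hM
  obtain ⟨C, hC⟩ := M.exists_norm_velInterp_le X hM
  choose Λ hΛ using fun i => (hb i).exists_norm_grad_le
  obtain ⟨p, hp, hvp⟩ := hv K
  obtain ⟨q, hq, hψq⟩ := hψ K
  have hΩb := M.isBounded_of_isMeshOf hM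
  have hS := M.isOpen_piece hM.isOpen K
  have hSΩ : M.piece Ω K ⊆ Ω := inter_subset_right
  have hVS : ∀ x ∈ M.piece Ω K, M.velInterp Ω X x = M.velGrad Ω X K x + M.velConst Ω X K :=
    fun x hx => M.velInterp_eq_affine X (M.piece_subset_elem K hx)
  obtain ⟨h1, h2, h3⟩ := hasDerivAt_convection hM.isOpen hL (M.velInterp_eq_zero X hM) hC hS
    (hΩb.subset hSΩ) hSΩ hVS (integrableOn_of_apply fun i => (hb i).integrableOn le_top hΩb)
    (fun i => (hb i).integrableOn_grad le_top hΩb) (fun i => (hb i).weak) hΛ hp hq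
  have e1 : EqOn (fun x => (∑ i, ⟪Db i x, M.velInterp Ω X x⟫_ℝ * ∇ p x i) * q x
      + ⟪b x, ∇ p x⟫_ℝ * q x * traceE (M.velGrad Ω X K))
      (fun x => (∑ i, ⟪Db i x, M.velInterp Ω X x⟫_ℝ * ∇ v x i) * ψ x
      + ⟪b x, ∇ v x⟫_ℝ * ψ x * divergence (M.velInterp Ω X) x) (M.piece Ω K) := fun x hx => by
    simp only [gradient_eq_of_mem_piece hvp hx, hψq (M.piece_subset_elem K hx),
      divergence_velInterp X hx]
  have e2 : EqOn (fun x => ⟪b x, star (M.velGrad Ω X K) (∇ p x)⟫_ℝ * q x)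
      (fun x => ⟪b x, mulE (((M.edge K)⁻¹)ᵀ * (M.edgeVel Ω X K)ᵀ) (∇ v x)⟫_ℝ * ψ x)
      (M.piece Ω K) := fun x hx => by
    simp only [gradient_eq_of_mem_piece hvp hx, hψq (M.piece_subset_elem K hx), mulE_star_velGrad]
  refine ⟨h1.congr_fun e1 hS.measurableSet, h2.congr_fun e2 hS.measurableSet, ?_⟩
  rw [← setIntegral_congr_fun hS.measurableSet e1, ← setIntegral_congr_fun hS.measurableSet e2]
  refine h3.congr_of_eventuallyEq ?_
  filter_upwards [eventually_det_ne_zero (M.velGrad Ω X K), eventually_abs_mul_lt_one L]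
    with t hdet ht
  rw [pieceAt, integral_flow_image hL ht hS.measurableSet hVS]
  congr 1
  refine setIntegral_congr_fun hS.measurableSet fun x hx => ?_
  simp only [gradient_push X hdet hv hx, push_flow X hdet hx,
    gradient_eq_of_mem_piece hvp hx, hψq (M.piece_subset_elem K hx)]

/-- The derivative at `t = 0` of the form on the deformed mesh. -/
theorem hasDerivAt_bilin_push (hM : M.IsMeshOf Ω) (ha : IsSobolevWith Ω ⊤ a Da)
    (hb : ∀ i, IsSobolevWith Ω ⊤ (fun x => b x i) (Db i)) (hc : IntegrableOn c Ω)
    (hv : M.PiecewiseSmooth v) (hψ : M.PiecewiseSmooth ψ) :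
    HasDerivAt (fun t => ∑ K, bilin (M.elemAt Ω X t K) a b c (M.push Ω X t K v) (M.push Ω X t K ψ))
      ((∫ x in Ω, (⟪Da x, M.velInterp Ω X x⟫_ℝ * ⟪∇ v x, ∇ ψ x⟫_ℝ
          + a x * ⟪∇ v x, ∇ ψ x⟫_ℝ * divergence (M.velInterp Ω X) x))
        + (∫ x in Ω, ((∑ i, ⟪Db i x, M.velInterp Ω X x⟫_ℝ * ∇ v x i) * ψ x
          + ⟪b x, ∇ v x⟫_ℝ * ψ x * divergence (M.velInterp Ω X) x))
        - (∑ K, ∫ x in M.elem K, (a x * ⟪∇ v x, mulE (M.edgeVel Ω X K * (M.edge K)⁻¹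
            + ((M.edge K)⁻¹)ᵀ * (M.edgeVel Ω X K)ᵀ) (∇ ψ x)⟫_ℝ
          + ⟪b x, mulE (((M.edge K)⁻¹)ᵀ * (M.edgeVel Ω X K)ᵀ) (∇ v x)⟫_ℝ * ψ x))
        - ∫ x in Ω, (c x * ψ x * ⟪∇ v x, M.velInterp Ω X x⟫_ℝ
          + c x * v x * ⟪∇ ψ x, M.velInterp Ω X x⟫_ℝ)) 0 := by
  obtain ⟨L, hL⟩ := M.exists_lipschitzWith_velInterp X hM
  have hΩb := M.isBounded_of_isMeshOf hM
  have hA := hasDerivAt_diffusion_push X hM ha hv hψ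
  have hB := hasDerivAt_convection_push X hM hb hv hψ
  -- Treated as a load with density c and function vψ, which is why no derivative of c and no
  -- divergence of V enters.
  have hC := hasDerivAt_sum_integral_load X hM (hv.mul hψ) hc
  have h := ((HasDerivAt.fun_sum (u := Finset.univ) fun K _ => (hA K).2.2).add
    (HasDerivAt.fun_sum (u := Finset.univ) fun K _ => (hB K).2.2)).add hC
  refine (h.congr_of_eventuallyEq ?_).congr_deriv ?_
  · have hdet : ∀ᶠ t : ℝ in 𝓝 0, ∀ K, (1 + t • M.velGrad Ω X K).det ≠ 0 :=
      eventually_all.2 fun K => eventually_det_ne_zero _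
    filter_upwards [hdet, eventually_abs_mul_lt_one L] with t hdet ht
    simp only [Pi.add_apply, ← Finset.sum_add_distrib]
    refine Finset.sum_congr rfl fun K _ => ?_
    exact bilin_elemAt_eq X hM hL ht (hdet K) hv hψ (ha.integrableOn le_top hΩb)
      (integrableOn_of_apply fun i => (hb i).integrableOn le_top hΩb) hc
  · rw [← M.sum_integral_piece hM (integrableOn_of_piece hM fun K => (hA K).1),
      ← M.sum_integral_piece hM (integrableOn_of_piece hM fun K => (hB K).1)]
    have e1 : ∀ K, ∫ x in M.elem K, (a x * ⟪∇ v x, mulE (M.edgeVel Ω X K * (M.edge K)⁻¹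
            + ((M.edge K)⁻¹)ᵀ * (M.edgeVel Ω X K)ᵀ) (∇ ψ x)⟫_ℝ
          + ⟪b x, mulE (((M.edge K)⁻¹)ᵀ * (M.edgeVel Ω X K)ᵀ) (∇ v x)⟫_ℝ * ψ x)
        = (∫ x in M.piece Ω K, a x * ⟪∇ v x, mulE (M.edgeVel Ω X K * (M.edge K)⁻¹
            + ((M.edge K)⁻¹)ᵀ * (M.edgeVel Ω X K)ᵀ) (∇ ψ x)⟫_ℝ)
          + ∫ x in M.piece Ω K,
            ⟪b x, mulE (((M.edge K)⁻¹)ᵀ * (M.edgeVel Ω X K)ᵀ) (∇ v x)⟫_ℝ * ψ x := fun K => by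
      rw [setIntegral_congr_set (elem_ae_eq_piece hM K), integral_add (hA K).2.1 (hB K).2.1]
    have e2 : ∫ x in Ω, c x * ⟪∇ (fun x => v x * ψ x) x, M.velInterp Ω X x⟫_ℝ
        = ∫ x in Ω, (c x * ψ x * ⟪∇ v x, M.velInterp Ω X x⟫_ℝ
          + c x * v x * ⟪∇ ψ x, M.velInterp Ω X x⟫_ℝ) := by
      refine integral_congr_ae (M.ae_restrict_of_piece hM fun K x hx => ?_)
      simp only [inner_gradient_mul (hv.differentiableAt hx) (hψ.differentiableAt hx)]
      ring
    simp only [e1, e2, Finset.sum_add_distrib, Finset.sum_sub_distrib]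
    ring

theorem sum_bilin_push_zero (hM : M.IsMeshOf Ω) (ha : IntegrableOn a Ω) (hb : IntegrableOn b Ω)
    (hc : IntegrableOn c Ω) (hv : M.PiecewiseSmooth v) (hψ : M.PiecewiseSmooth ψ) :
    ∑ K, bilin (M.elemAt Ω X 0 K) a b c (M.push Ω X 0 K v) (M.push Ω X 0 K ψ)
      = bilin Ω a b c v ψ := by
  obtain ⟨L, hL⟩ := M.exists_lipschitzWith_velInterp X hM
  have hvert : ∀ K, M.vertAt Ω X 0 K = M.vert K := fun K => by funext j; simp [vertAt]
  have hpush : ∀ K (v : E d → ℝ), M.push Ω X 0 K v = v := fun K v => by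
    funext x
    rw [push, hvert, elementMap_self (M.det_vert K)]
  have hpiece : ∀ K, M.pieceAt Ω X 0 K = M.piece Ω K := fun K => by simp [pieceAt, flow_zero]
  have hint : IntegrableOn (fun y => a y * ⟪∇ v y, ∇ ψ y⟫_ℝ + ⟪b y, ∇ v y⟫_ℝ * ψ y
      + c y * v y * ψ y) Ω := integrableOn_of_piece hM fun K => by
    have := integrableOn_bilin_push (K := K) X hM hL (t := 0) (by simp)
      (by simp [det_one_add_zero_smul]) hv hψ ha hb hc
    simpa only [hpush, hpiece] using this
  rw [bilin, ← M.sum_integral_piece hM hint]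
  refine Finset.sum_congr rfl fun K _ => ?_
  rw [bilin, setIntegral_congr_set (M.elemAt_ae_eq X hM K), hpush, hpush]
  change ∫ y in M.pieceAt Ω X 0 K, _ = _
  rw [hpiece]

theorem sum_load_push_zero (hM : M.IsMeshOf Ω) {f : E d → ℝ} (hf : IntegrableOn f Ω)
    (hv : M.PiecewiseSmooth v) :
    ∑ K, ∫ y in M.elemAt Ω X 0 K, f y * M.push Ω X 0 K v y = ∫ x in Ω, f x * v x := by
  have hvert : ∀ K, M.vertAt Ω X 0 K = M.vert K := fun K => by funext j; simp [vertAt]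
  have hpush : ∀ K (v : E d → ℝ), M.push Ω X 0 K v = v := fun K v => by
    funext x
    rw [push, hvert, elementMap_self (M.det_vert K)]
  rw [← M.sum_integral_piece hM (hv.integrableOn_mul hM hf)]
  refine Finset.sum_congr rfl fun K _ => ?_
  rw [hpush, setIntegral_congr_set (M.elemAt_ae_eq X hM K)]
  simp [flow_zero]

end Derivative

end SimplicialMesh

end

end MeshSens

/-! ### The equation of the material derivative -/

theorem theorem3p1 {d : ℕ} (hd : 1 ≤ d) {N T κ : Type*} [Fintype N] [Fintype T] [Fintype κ]
    -- the domain, its mesh, and a basis of the finite element space of degree `r`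
    (Ω : Set (E d)) (M : SimplicialMesh d N T) (hM : M.IsMeshOf Ω)
    (r : ℕ) (B : Module.Basis κ ℝ (FESpace M Ω r))
    -- the coefficients; `Da`, `Db i`, `Dc`, `Df` are the weak gradients of `a`, `b i`, `c`, `f`
    (a c f : E d → ℝ) (b : E d → E d) (Da Dc Df : E d → E d) (Db : Fin d → E d → E d)
    (ha : IsSobolevWith Ω ⊤ a Da)
    (hb : ∀ i, IsSobolevWith Ω ⊤ (fun x => b x i) (Db i))
    (hc : IsSobolevWith Ω ⊤ c Dc)
    (hf : IsSobolevWith Ω 2 f Df)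
    (a₀ : ℝ) (ha₀ : 0 < a₀)
    (ha_ge : ∀ᵐ x ∂(volume.restrict Ω), a₀ ≤ a x)
    (hcb : ∀ᵐ x ∂(volume.restrict Ω), 0 ≤ c x - 1 / 2 * ∑ i, Db i x i)
    -- the velocity field
    (X : E d → E d) (hX : ContDiffOn ℝ ∞ X Ω)
    (hX_bdd : ∃ C : ℝ, ∀ x ∈ Ω, ‖X x‖ ≤ C)
    (hDX_bdd : ∃ C : ℝ, ∀ x ∈ Ω, ‖fderiv ℝ X x‖ ≤ C)
    -- `U t` is the coefficient vector of the solution on the mesh at time `t`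
    (δ : ℝ) (hδ : 0 < δ) (U : ℝ → κ → ℝ) (U' : κ → ℝ)
    (u : ℝ → E d → ℝ) (hu : ∀ t x, u t x = ∑ i, U t i * (B i : E d → ℝ) x)
    (h_sol : IsFESolution M Ω r a b c f (u 0))
    (h_sol_t : ∀ t ∈ Set.Ioo 0 δ, IsDeformedFESolution M Ω r a b c f X t (u t))
    (hU : HasDerivWithinAt U U' (Set.Ici 0) 0)
    -- the finite element solution and its material derivative
    (u_h u_dot : E d → ℝ) (hu_h : u_h = u 0)
    (hu_dot : ∀ x, u_dot x = ∑ i, U' i * (B i : E d → ℝ) x)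
    -- the interpolated velocity field
    (Xh : E d → E d) (hXh : Xh = M.velInterp Ω X) :
    u_dot ∈ FESpace M Ω r ∧
    ∀ ψ ∈ FESpace M Ω r,
      (∫ x in Ω, (a x * inner ℝ (∇ u_dot x) (∇ ψ x) + inner ℝ (b x) (∇ u_dot x) * ψ x
          + c x * u_dot x * ψ x))
        = (∑ K, (∫ x in M.elem K,
            (a x * inner ℝ (∇ u_h x)
                (mulE (M.edgeVel Ω X K * (M.edge K)⁻¹ + ((M.edge K)⁻¹)ᵀ * (M.edgeVel Ω X K)ᵀ)
                  (∇ ψ x))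
              + inner ℝ (b x) (mulE (((M.edge K)⁻¹)ᵀ * (M.edgeVel Ω X K)ᵀ) (∇ u_h x)) * ψ x)))
          - (∫ x in Ω, (inner ℝ (Da x) (Xh x) * inner ℝ (∇ u_h x) (∇ ψ x)
              + a x * inner ℝ (∇ u_h x) (∇ ψ x) * divergence Xh x))
          - (∫ x in Ω, ((∑ i, inner ℝ (Db i x) (Xh x) * (∇ u_h x) i) * ψ x
              + inner ℝ (b x) (∇ u_h x) * ψ x * divergence Xh x))
          + (∫ x in Ω, (c x * ψ x * inner ℝ (∇ u_h x) (Xh x)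
              + c x * u_h x * inner ℝ (∇ ψ x) (Xh x)))
          - (∫ x in Ω, f x * inner ℝ (∇ ψ x) (Xh x)) := by
  have hps : ∀ {v}, v ∈ FESpace M Ω r → M.PiecewiseSmooth v :=
    fun hv => SimplicialMesh.piecewiseSmooth_of_mem hv
  have hB : ∀ i, M.PiecewiseSmooth (B i : E d → ℝ) := fun i => hps (B i).2
  have hΩb := M.isBounded_of_isMeshOf hM
  have hai := ha.integrableOn le_top hΩb
  have hbi : IntegrableOn b Ω := integrableOn_of_apply fun i => (hb i).integrableOn le_top hΩb
  have hci := hc.integrableOn le_top hΩb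
  have hfi := hf.integrableOn (by norm_num) hΩb
  have hu' : ∀ t, u t = fun x => ∑ i, U t i * (B i : E d → ℝ) x := fun t => funext (hu t)
  have hu_dot' : u_dot = fun x => ∑ i, U' i * (B i : E d → ℝ) x := funext hu_dot
  subst hu_h hXh
  refine ⟨?_, fun ψ hψV => ?_⟩
  · have h : u_dot = ((∑ i, U' i • B i : FESpace M Ω r) : E d → ℝ) := by
      funext x
      rw [hu_dot]
      simp [Finset.sum_apply]
    rw [h]
    exact Subtype.coe_prop _
  have hψ := hps hψV
  obtain ⟨L, hL⟩ := M.exists_lipschitzWith_velInterp X hM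
  have hsmall : ∀ᶠ t : ℝ in 𝓝 0, |t| * L < 1 ∧ ∀ K, (1 + t • M.velGrad Ω X K).det ≠ 0 :=
    (eventually_abs_mul_lt_one L).and (eventually_all.2 fun K => eventually_det_ne_zero _)
  set form : ℝ → (E d → ℝ) → ℝ := fun t v =>
    ∑ K, bilin (M.elemAt Ω X t K) a b c (M.push Ω X t K v) (M.push Ω X t K ψ) with hform
  set load : ℝ → ℝ := fun t => ∑ K, ∫ y in M.elemAt Ω X t K, f y * M.push Ω X t K ψ y with hload
  have hlin : ∀ t : ℝ, |t| * L < 1 → (∀ K, (1 + t • M.velGrad Ω X K).det ≠ 0) → ∀ y : κ → ℝ,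
      form t (fun x => ∑ i, y i * (B i : E d → ℝ) x) = ∑ i, y i * form t (B i) := by
    intro t ht hdet y
    simp only [hform, Finset.mul_sum]
    rw [Finset.sum_comm]
    exact Finset.sum_congr rfl fun K _ =>
      SimplicialMesh.bilin_elemAt_sum X hM hL ht (hdet K) hψ hB y hai hbi hci
  have hform' : ∀ {v}, M.PiecewiseSmooth v → HasDerivAt (fun t => form t v) _ 0 := fun {v} hv =>
    SimplicialMesh.hasDerivAt_bilin_push X hM ha hb hci hv hψ
  have hload' : HasDerivAt load (-∫ x in Ω, f x * inner ℝ (∇ ψ x) (M.velInterp Ω X x)) 0 := by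
    have h := SimplicialMesh.hasDerivAt_sum_integral_load X hM hψ hfi
    refine h.congr_of_eventuallyEq (Eventually.of_forall fun t => ?_)
    exact Finset.sum_congr rfl fun K _ => setIntegral_congr_set (M.elemAt_ae_eq X hM K)
  have hu0 : M.PiecewiseSmooth (u 0) := hps h_sol.1
  have hUi : ∀ i, HasDerivWithinAt (fun t => U t i) (U' i) (Set.Ici 0) 0 :=
    hasDerivWithinAt_pi.1 hU
  -- The increments U t i − U 0 i vanish at 0, so in the product rule the derivatives of `form t (B
  -- i)` drop out and only U' i times `form 0 (B i)` survives.
  have hsum := HasDerivWithinAt.fun_sum (u := Finset.univ) fun i _ =>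
    ((hUi i).sub_const (U 0 i)).mul (hform' (hB i)).hasDerivWithinAt
  have htotal := (hform' hu0).hasDerivWithinAt (s := Set.Ici 0) |>.add hsum
  have heq : (fun t => form t (u 0) + ∑ i, (U t i - U 0 i) * form t (B i))
      =ᶠ[𝓝[Set.Ici 0] 0] load := by
    have hδ' : ∀ᶠ t : ℝ in 𝓝[Set.Ici 0] 0, t < δ := nhdsWithin_le_nhds (eventually_lt_nhds hδ)
    filter_upwards [nhdsWithin_le_nhds hsmall, hδ', self_mem_nhdsWithin] with t ⟨ht, hdet⟩ htδ ht0
    have h1 : form t (u 0) + ∑ i, (U t i - U 0 i) * form t (B i) = form t (u t) := by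
      rw [hu' t, hu' 0, hlin t ht hdet, hlin t ht hdet]
      simp only [sub_mul, Finset.sum_sub_distrib]
      ring
    rw [h1]
    -- The deformed equations are given for t > 0 only; at t = 0 they reduce to the original finite
    -- element problem.
    rcases (show (0 : ℝ) ≤ t from ht0).eq_or_lt with h0 | h0
    · subst h0
      simp only [hform, hload]
      rw [SimplicialMesh.sum_bilin_push_zero X hM hai hbi hci hu0 hψ,
        SimplicialMesh.sum_load_push_zero X hM hfi hψ]
      exact h_sol.2 ψ hψV
    · exact (h_sol_t t ⟨h0, htδ⟩).2 ψ hψV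
  -- Both sides of the equation coincide to the right of 0, where one-sided derivatives are unique.
  have hderiv := (uniqueDiffWithinAt_Ici (0 : ℝ)).eq_deriv _
    (htotal.congr_of_eventuallyEq heq.symm (heq.symm.self_of_nhdsWithin Set.self_mem_Ici))
    hload'.hasDerivWithinAt
  have hdot : ∑ i, U' i * form 0 (B i) = bilin Ω a b c u_dot ψ := by
    obtain ⟨h0, hdet0⟩ := hsmall.self_of_nhds
    rw [← hlin 0 h0 hdet0, ← hu_dot']
    exact SimplicialMesh.sum_bilin_push_zero X hM hai hbi hci
      (hu_dot' ▸ SimplicialMesh.PiecewiseSmooth.sum hB U') hψ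
  simp only [sub_self, zero_mul, add_zero, hdot] at hderiv
  change bilin Ω a b c u_dot ψ = _
  linarith
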